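/- Let $A=(b_i)_{i\ge 1}$ be a sequence of integers $b_i\ge 2$. Every $x\in[0,1]$ has an $A$-Cantor series expansion $x=\sum_{i\ge1}\epsilon_i(x)/(b_1\cdots b_i)$ with digits $\epsilon_i(x)\in\{0,\dots,b_i-1\}$ (for $x<1$ with two expansions take the terminating one). Assume that for every $k$ the limit $d_k=\lim_{N\to\infty}\frac1N\#\{i\le N: b_i=k\}$ exists and that $\sum_{n\ge2}d_n=1$. Let $\alpha=(\alpha_j)_{j\ge0}$ be a stochastic vector ($\alpha_j\ge0$, $\sum_j\alpha_j=1$). Put $$J_A(\alpha)=\Big\{x\in[0,1]:\ \lim_{N\to\infty}\tfrac1N\#\{i\le N:\epsilon_i(x)=j\}=\alpha_j\ \text{ for all } j\ge0\Big\}.$$ Let $\pi$ be the set of all $P=(p_{n,j})_{n\ge2,\,0\le j<n}$ with $p_{n,j}\ge0$ and $\sum_{j=0}^{n-1}p_{n,j}=1$ for every $n\ge 2$ (with $p_{n,j}=0$ for $j\ge n$), let $\pi(\alpha)=\{P\in\pi:\ \sum_{n\ge2}d_np_{n,j}=\alpha_j\ \text{for all } j\ge 0\}$, and for $P\in\pi$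 put $$J_A(P)=\Big\{x\in[0,1]:\ \lim_{N\to\infty}\tfrac1N\#\{i\le N: b_i=n,\ \epsilon_i(x)=j\}=d_np_{n,j}\ \text{ for all } n\ge 2,\ 0\le j<n\Big\},$$ $$Q(P)=\frac{-\sum_{n\ge2}d_n\sum_{j=0}^{n-1}p_{n,j}\log p_{n,j}}{\sum_{n\ge2}d_n\log n}\qquad(0\log 0=0).$$ Put $j_0=\min\{j:\alpha_j\ne0\}$, $d_1=0$, and $$A_n=\sum_{j=j_0}^{n-1}\alpha_j-\sum_{k=j_0+1}^{n-1}d_k,\qquad r_n=\frac1{A_n}\prod_{k=j_0+1}^{n-1}\Big(1-\frac{d_k}{A_k}\Big),\qquad t_j=\frac{\alpha_j}{\prod_{k=j_0+1}^{j}\big(1-\frac{d_k}{A_k}\big)},$$ where a factor $1-d_k/A_k$ with $A_k=0$ is read as $1$. Let $P^\alpha=(p^\alpha_{n,j})$ be the matrix with $p^\alpha_{n,j}=r_nt_j$ for $j_0\le j<n$, that is, after cancelling the common factors of $r_n$ and $t_j$, $$p^\alpha_{n,j}=\frac{\alpha_j}{A_n}\prod_{k=j+1}^{n-1}\Big(1-\frac{d_k}{A_k}\Big)\qquad(n>j_0,\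 A_n\ne0,\ j_0\le j<n)$$ (the cancelled form is the definition also when the denominator of $t_j$ vanishes), with $p^\alpha_{n,j}=0$ for $n>j_0$, $A_n\neq 0$, $j<j_0$, and with uniform rows $p^\alpha_{n,j}=1/n$, $0\le j<n$, if $n\le j_0$ or $A_n=0$. Assume that $\pi(\alpha)\ne\emptyset$. Then: 1. $P^\alpha\in\pi(\alpha)$; moreover $p^\alpha_{n,j}=r_nt_j$ whenever $j_0\le j<n$, $A_n\ne0$ and the denominator of $t_j$ is non-zero; and $d_n=0$ for every $n$ with $n\le j_0$ or $A_n=0$. 2. $J_A(P^\alpha)\subseteq J_A(\alpha)$ and $\dim_HJ_A(P^\alpha)=\dim_HJ_A(\alpha)$. 3. The supremum in $\dim_HJ_A(\alpha)=\sup_{P\in\pi(\alpha)}\dim_HJ_A(P)$ is attained at $P=P^\alpha$. 4. If $\sum_n d_n\log n<\infty$, then also $\sup_{P\in\pi(\alpha)}Q(P)$ is attained at $P=P^\alpha$. If moreover $\frac1N\sum_{i=1}^N\log b_i\to\sum_nd_n\log n$ as $N\to\infty$ (for example, if $A$ is bounded), then $\dim_HJ_A(\alpha)=Q(P^\alpha)=\max_{P\in\pi(\alpha)}Q(P)$.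 -/

import Mathlib

namespace CantorSeries

noncomputable section

/-!
Sequences are indexed from `0`: the base `b i` and the digit `digit b x i` are the
`(i+1)`-st base and the `(i+1)`-st digit.
-/

/-- The digits of `x ∈ [0,1]` in the Cantor series with bases `b 0, b 1, …`. A number in `[0,1)`
with two expansions gets the terminating one; the number `1` gets its only expansion. -/
def digit (b : ℕ → ℕ) (x : ℝ) (i : ℕ) : ℕ :=
  if x = 1 then b i - 1 else ⌊x * (∏ k ∈ Finset.range (i + 1), b k : ℕ)⌋₊ % b i

theorem digit_lt {b : ℕ → ℕ} (hb : ∀ i, 2 ≤ b i) (x : ℝ) (i : ℕ) : digit b x i < b i := by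
  have := hb i
  unfold digit
  split_ifs
  · omega
  · exact Nat.mod_lt _ (by omega)

/-- The digits of `x ∈ [0,1]` do give a Cantor series expansion of `x`. -/
theorem hasSum_digit {b : ℕ → ℕ} (hb : ∀ i, 2 ≤ b i) {x : ℝ} (hx : x ∈ Set.Icc (0 : ℝ) 1) :
    HasSum (fun i => (digit b x i : ℝ) / (∏ k ∈ Finset.range (i + 1), b k : ℕ)) x := by
  have hb0 : ∀ i, (b i : ℝ) ≠ 0 := fun i => by
    have := hb i
    exact_mod_cast (by omega : b i ≠ 0)
  have hpos : ∀ n, (0 : ℝ) < (∏ k ∈ Finset.range n, b k : ℕ) := fun n => by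
    exact_mod_cast Finset.prod_pos fun i _ => by have := hb i; omega
  have hpow : ∀ n, (2 : ℝ) ^ n ≤ (∏ k ∈ Finset.range n, b k : ℕ) := fun n => by
    have : (2 : ℕ) ^ n ≤ ∏ k ∈ Finset.range n, b k := by
      simpa using Finset.pow_card_le_prod (Finset.range n) b 2 (fun i _ => hb i)
    exact_mod_cast this
  have key : ∀ n, x - 1 / (∏ k ∈ Finset.range n, b k : ℕ) ≤
      ∑ i ∈ Finset.range n, (digit b x i : ℝ) / (∏ k ∈ Finset.range (i + 1), b k : ℕ) ∧
      ∑ i ∈ Finset.range n, (digit b x i : ℝ) / (∏ k ∈ Finset.range (i + 1), b k : ℕ) ≤ x := by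
    intro n
    by_cases h1 : x = 1
    · have : ∑ i ∈ Finset.range n, (digit b x i : ℝ) / (∏ k ∈ Finset.range (i + 1), b k : ℕ) =
          1 - 1 / (∏ k ∈ Finset.range n, b k : ℕ) := by
        induction n with
        | zero => simp
        | succ n ih =>
          rw [Finset.sum_range_succ, ih, digit, if_pos h1,
            Nat.cast_sub (by have := hb n; omega), Finset.prod_range_succ]
          have := (hpos n).ne'
          have := hb0 n
          push_cast at *
          field_simp
          ring
      rw [this, h1]
      exact ⟨le_rfl, sub_le_self _ (one_div_nonneg.2 (hpos n).le)⟩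
    · have : ∑ i ∈ Finset.range n, (digit b x i : ℝ) / (∏ k ∈ Finset.range (i + 1), b k : ℕ) =
          (⌊x * (∏ k ∈ Finset.range n, b k : ℕ)⌋₊ : ℝ) / (∏ k ∈ Finset.range n, b k : ℕ) := by
        induction n with
        | zero => simp [Nat.floor_eq_zero.2 (lt_of_le_of_ne hx.2 h1)]
        | succ n ih =>
          have hdiv : ⌊x * (∏ k ∈ Finset.range (n + 1), b k : ℕ)⌋₊ / b n =
              ⌊x * (∏ k ∈ Finset.range n, b k : ℕ)⌋₊ := by
            rw [← Nat.floor_div_natCast]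
            congr 1
            rw [Finset.prod_range_succ]
            have := hb0 n
            push_cast
            field_simp
          have hmod := Nat.div_add_mod ⌊x * (∏ k ∈ Finset.range (n + 1), b k : ℕ)⌋₊ (b n)
          rw [hdiv] at hmod
          rw [Finset.sum_range_succ, ih, digit, if_neg h1]
          have h2 : (b n : ℝ) * (⌊x * (∏ k ∈ Finset.range n, b k : ℕ)⌋₊ : ℝ) +
              ((⌊x * (∏ k ∈ Finset.range (n + 1), b k : ℕ)⌋₊ % b n : ℕ) : ℝ) =
              (⌊x * (∏ k ∈ Finset.range (n + 1), b k : ℕ)⌋₊ : ℝ) := by exact_mod_cast hmod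
          rw [← h2]
          have hp : ((∏ k ∈ Finset.range (n + 1), b k : ℕ) : ℝ) =
              (∏ k ∈ Finset.range n, b k : ℕ) * b n := by
            rw [Finset.prod_range_succ, Nat.cast_mul]
          rw [add_div]
          congr 1
          rw [hp]
          have := (hpos n).ne'
          have := hb0 n
          field_simp
      rw [this]
      have hn : 0 ≤ x * (∏ k ∈ Finset.range n, b k : ℕ) := mul_nonneg hx.1 (hpos n).le
      refine ⟨?_, (div_le_iff₀ (hpos n)).2 (Nat.floor_le hn)⟩
      rw [le_div_iff₀ (hpos n), sub_mul, div_mul_cancel₀ _ (hpos n).ne']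
      linarith [Nat.lt_floor_add_one (x * (∏ k ∈ Finset.range n, b k : ℕ))]
  rw [hasSum_iff_tendsto_nat_of_nonneg (fun i => by positivity)]
  refine tendsto_of_tendsto_of_tendsto_of_le_of_le (g := fun n : ℕ => x - (1 / 2 : ℝ) ^ n)
    (h := fun _ => x) ?_ tendsto_const_nhds (fun n => ?_) (fun n => (key n).2)
  · simpa using (tendsto_const_nhds (x := x)).sub
      (tendsto_pow_atTop_nhds_zero_of_lt_one (r := (1 / 2 : ℝ)) (by norm_num) (by norm_num))
  · refine le_trans ?_ (key n).1
    have h := one_div_le_one_div_of_le (by positivity) (hpow n)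
    simp only [one_div, inv_pow] at h ⊢
    linarith

/-- Number of occurrences of the digit `j` among the first `n` digits of `x`. -/
def digitCount (b : ℕ → ℕ) (x : ℝ) (j n : ℕ) : ℕ :=
  ((Finset.range n).filter fun i => digit b x i = j).card

/-- Number of occurrences of the base `k` among the first `n` bases. -/
def baseCount (b : ℕ → ℕ) (k n : ℕ) : ℕ :=
  ((Finset.range n).filter fun i => b i = k).card

/-- Number of positions among the first `n` where the base is `k` and the digit of `x` is `j`. -/
def jointCount (b : ℕ → ℕ) (x : ℝ) (k j n : ℕ) : ℕ :=
  ((Finset.range n).filter fun i => b i = k ∧ digit b x i = j).card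

/-- `d k` is the (existing) asymptotic frequency of the base `k`, for every `k`. -/
def IsBaseFrequency (b : ℕ → ℕ) (d : ℕ → ℝ) : Prop :=
  ∀ k, Filter.Tendsto (fun n : ℕ => (baseCount b k n : ℝ) / n) Filter.atTop (nhds (d k))

/-- A probability vector indexed by `0, 1, 2, …`. -/
def IsStochastic (α : ℕ → ℝ) : Prop :=
  (∀ j, 0 ≤ α j) ∧ HasSum α 1

/-- `J_A(α)`: the points of `[0,1]` whose digit frequencies exist and are given by `α`. -/
def levelSet (b : ℕ → ℕ) (α : ℕ → ℝ) : Set ℝ :=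
  {x | x ∈ Set.Icc (0 : ℝ) 1 ∧ ∀ j,
    Filter.Tendsto (fun n : ℕ => (digitCount b x j n : ℝ) / n) Filter.atTop (nhds (α j))}

/-- `J_A(P)`: the points of `[0,1]` for which the joint frequency of base `k` and digit `j`
exists and equals `d k * P k j`. -/
def jointLevelSet (b : ℕ → ℕ) (d : ℕ → ℝ) (P : ℕ → ℕ → ℝ) : Set ℝ :=
  {x | x ∈ Set.Icc (0 : ℝ) 1 ∧ ∀ k, 2 ≤ k → ∀ j < k,
    Filter.Tendsto (fun n : ℕ => (jointCount b x k j n : ℝ) / n) Filter.atTop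
      (nhds (d k * P k j))}

/-- `π`: triangular stochastic matrices `(P n j)`, `n ≥ 2`, `0 ≤ j < n`, extended by `0` to
`j ≥ n`. The rows `0` and `1` carry no information. -/
def stochMatrices : Set (ℕ → ℕ → ℝ) :=
  {P | ∀ n, 2 ≤ n → (∀ j, 0 ≤ P n j) ∧ (∀ j, n ≤ j → P n j = 0) ∧
    ∑ j ∈ Finset.range n, P n j = 1}

/-- `π(α)`: the matrices in `π` with `∑ₙ d n * P n j = α j` for every `j`, over `n ≥ 2`. -/
def admissible (d α : ℕ → ℝ) : Set (ℕ → ℕ → ℝ) :=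
  {P | P ∈ stochMatrices ∧ ∀ j, HasSum (fun n => if 2 ≤ n then d n * P n j else 0) (α j)}

/-- The entropy quotient
`(-∑ₙ d n ∑_{j<n} P n j log (P n j)) / ∑ₙ d n log n` of a matrix. -/
def entropyQuotient (d : ℕ → ℝ) (P : ℕ → ℕ → ℝ) : ℝ :=
  (∑' n, if 2 ≤ n then -(d n * ∑ j ∈ Finset.range n, P n j * Real.log (P n j)) else 0) /
    ∑' n, if 2 ≤ n then d n * Real.log n else 0

/-- `j₀`, the least `j` with `α j ≠ 0`. -/
def jMin (α : ℕ → ℝ) : ℕ := sInf {j | α j ≠ 0}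

/-- `A_n = ∑_{j=j₀}^{n-1} α_j - ∑_{k=j₀+1}^{n-1} d_k`. -/
def massA (d α : ℕ → ℝ) (n : ℕ) : ℝ :=
  ∑ j ∈ Finset.Ico (jMin α) n, α j - ∑ k ∈ Finset.Ico (jMin α + 1) n, d k

/-- The factor `1 - d_k / A_k`. -/
def factor (d α : ℕ → ℝ) (k : ℕ) : ℝ := 1 - d k / massA d α k

/-- `r_n = (1 / A_n) ∏_{k=j₀+1}^{n-1} (1 - d_k / A_k)`. -/
def rSeq (d α : ℕ → ℝ) (n : ℕ) : ℝ :=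
  1 / massA d α n * ∏ k ∈ Finset.Ico (jMin α + 1) n, factor d α k

/-- `t_j = α_j / ∏_{k=j₀+1}^{j} (1 - d_k / A_k)`. -/
def tSeq (d α : ℕ → ℝ) (j : ℕ) : ℝ :=
  α j / ∏ k ∈ Finset.Icc (jMin α + 1) j, factor d α k

/-- The matrix `P^α`. For `n > j₀`, `A_n ≠ 0` and `j₀ ≤ j < n` the entry is `r_n t_j` with the
common factors of `r_n` and `t_j` cancelled,
`(α_j / A_n) ∏_{k=j+1}^{n-1} (1 - d_k / A_k)`; it is `0` for the other `j`. The cancelled form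
also makes sense if a factor in the denominator of `t_j` vanishes. If `n ≤ j₀` or `A_n = 0`,
the row is uniform. -/
def optMatrix (d α : ℕ → ℝ) (n j : ℕ) : ℝ :=
  if jMin α < n ∧ massA d α n ≠ 0 then
    if jMin α ≤ j ∧ j < n then
      α j / massA d α n * ∏ k ∈ Finset.Ico (j + 1) n, factor d α k
    else 0
  else if j < n then 1 / (n : ℝ) else 0

end

end CantorSeries

namespace CantorSeries

open Filter Topology Finset

/-! ### Frequencies -/

/-! The matrix `P^α` allocates digit mass proportionally. Treat the bases in increasing order; base
`n` takes mass `d n` from the digits below `n`, in proportion to what the smaller bases have left of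
each (`remaining`). The mass available is then exactly `A_n` (`sum_remaining`), the masses taken
telescope, and `A_n → 0` because `α` and `d` both have total mass 1; hence `P^α` is admissible.

It is optimal because `-log p^α_{n,j}` is a function of `j`, plus a function of `n`, plus a sum over
the `k` with `j < k < n` (`logLoss`). A base at most `k` forces a digit below `k`, so the mass of
the pairs with `j < k < n` equals (mass of digits below `k`) minus (mass of bases at most `k`).
Hence the cross entropy relative to `P^α` depends only on the two marginals, and Gibbs' inequality
shows that `P^α` maximizes the mean entropy (`tsum_mul_rowEntropy_le`). Sums are truncated at a base
`T`, since the separate parts have to be controlled before they can be recombined.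

The same remark applied to empirical counts bounds the `P^α`-weight of the cylinders around every
point of `J_A(α)` from below, although joint frequencies need not exist there. Few cylinders have
large weight, which gives the upper bound `dimH_levelSet_le`. For the lower bound, digits are drawn
independently, with law `P (b i)` for bases below a slowly growing threshold and uniformly
otherwise; a mass distribution principle yields `le_dimH_jointLevelSet`.

Write `B_N` for the product of the first `N` bases, `H = ∑ d n log n`, `E` for the mean entropy of
`P^α`, `D = H - E`. The upper bound applies if `(1 - s) log B_N` is below about `D N` infinitely
often, the lower bound if it is eventually above about `D N`. These conditions are complementary up
to an arbitrarily small change of `s`, so the dimensions agree without any assumption on the growth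
of `B_N`. If `log B_N / N → ∞`, every `J_A(P)` has full dimension; otherwise `H < ∞`. -/

theorem tendsto_average_of_frequency {ι : Type*} [DecidableEq ι] (u : ℕ → ι) (s : Finset ι)
    (θ g : ι → ℝ)
    (h : ∀ a ∈ s, Tendsto (fun N : ℕ => (((range N).filter fun i => u i = a).card : ℝ) / N)
      atTop (𝓝 (θ a))) :
    Tendsto (fun N : ℕ => (∑ i ∈ range N, if u i ∈ s then g (u i) else 0) / (N : ℝ)) atTop
      (𝓝 (∑ a ∈ s, θ a * g a)) := by
  have key : ∀ N : ℕ, (∑ i ∈ range N, if u i ∈ s then g (u i) else 0) / (N : ℝ) =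
      ∑ a ∈ s, ((((range N).filter fun i => u i = a).card : ℝ) / N) * g a := by
    intro N
    have h1 : ∀ i, (if u i ∈ s then g (u i) else 0) = ∑ a ∈ s, if u i = a then g a else 0 := by
      intro i
      rw [Finset.sum_ite_eq]
    simp_rw [h1]
    rw [Finset.sum_comm, Finset.sum_div]
    refine Finset.sum_congr rfl fun a _ => ?_
    rw [← Finset.sum_filter, Finset.sum_const, nsmul_eq_mul]
    ring
  simp_rw [key]
  exact tendsto_finsetSum _ fun a ha => (h a ha).mul_const _

theorem baseFrequency_nonneg {b : ℕ → ℕ} {d : ℕ → ℝ} (hd : IsBaseFrequency b d) (n : ℕ) :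
    0 ≤ d n :=
  ge_of_tendsto' (hd n) fun _ => by positivity

theorem baseFrequency_eq_zero {b : ℕ → ℕ} (hb : ∀ i, 2 ≤ b i) {d : ℕ → ℝ}
    (hd : IsBaseFrequency b d) {n : ℕ} (hn : n < 2) : d n = 0 := by
  refine tendsto_nhds_unique (hd n) ?_
  have : ∀ N, baseCount b n N = 0 := fun N => by
    unfold baseCount
    rw [Finset.card_eq_zero, Finset.filter_eq_empty_iff]
    intro i _ h
    have := hb i
    omega
  simp [this]

/-- Joint frequencies given by an admissible matrix force the digit frequencies. -/
theorem tendsto_digit_of_tendsto_joint {b : ℕ → ℕ} (hb : ∀ i, 2 ≤ b i) {d : ℕ → ℝ}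
    (hd : IsBaseFrequency b d) (hd1 : HasSum d 1) {α : ℕ → ℝ} {P : ℕ → ℕ → ℝ}
    (hP : P ∈ admissible d α) {e : ℕ → ℕ} (he : ∀ i, e i < b i)
    (hJ : ∀ k, 2 ≤ k → ∀ j < k, Tendsto
      (fun n : ℕ => (((range n).filter fun i => b i = k ∧ e i = j).card : ℝ) / n) atTop
      (𝓝 (d k * P k j))) (j : ℕ) :
    Tendsto (fun n : ℕ => (((range n).filter fun i => e i = j).card : ℝ) / n) atTop
      (𝓝 (α j)) := by
  have hJ' : ∀ k, Tendsto
      (fun n : ℕ => (((range n).filter fun i => b i = k ∧ e i = j).card : ℝ) / n) atTop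
      (𝓝 (if 2 ≤ k then d k * P k j else 0)) := by
    intro k
    by_cases hk : 2 ≤ k ∧ j < k
    · rw [if_pos hk.1]
      exact hJ k hk.1 j hk.2
    · have h0 : ∀ n, ((range n).filter fun i => b i = k ∧ e i = j).card = 0 := fun n => by
        rw [Finset.card_eq_zero, Finset.filter_eq_empty_iff]
        rintro i _ ⟨h1, h2⟩
        have := hb i
        have := he i
        omega
      have h1 : (if 2 ≤ k then d k * P k j else 0) = 0 := by
        split_ifs with h
        · rw [((hP.1 k h).2.1 j (by omega)), mul_zero]
        · rfl
      rw [h1]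
      simp [h0]
  have hlow : ∀ T n : ℕ, ∑ k ∈ range T,
      (((range n).filter fun i => b i = k ∧ e i = j).card : ℝ) / n ≤
      (((range n).filter fun i => e i = j).card : ℝ) / n := by
    intro T n
    rw [← Finset.sum_div]
    gcongr
    rw [← Nat.cast_sum, Nat.cast_le, ← Finset.card_biUnion]
    · refine Finset.card_le_card fun i hi => ?_
      simp only [Finset.mem_biUnion, Finset.mem_filter] at hi ⊢
      obtain ⟨k, _, h1, _, h2⟩ := hi
      exact ⟨h1, h2⟩
    · intro k _ k' _ hkk
      rw [Function.onFun, Finset.disjoint_filter]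
      rintro i _ ⟨h1, _⟩ ⟨h2, _⟩
      exact hkk (h1.symm.trans h2)
  -- The error is the share of bases at least `T`; its limit `1 - ∑_{k<T} d k` is small because `∑ d
  -- = 1`. Keeping `n / n` instead of `1` makes the proof uniform in `n`, including `n = 0`.
  have hupp : ∀ T n : ℕ, (((range n).filter fun i => e i = j).card : ℝ) / n ≤ ∑ k ∈ range T,
      (((range n).filter fun i => b i = k ∧ e i = j).card : ℝ) / n +
      ((n : ℝ) / n - ∑ k ∈ range T, (baseCount b k n : ℝ) / n) := by
    intro T n
    rw [← Finset.sum_div, ← Finset.sum_div, ← sub_div, ← add_div]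
    gcongr
    have h1 : ((range n).filter fun i => e i = j).card + ∑ k ∈ range T, baseCount b k n ≤
        ∑ k ∈ range T, ((range n).filter fun i => b i = k ∧ e i = j).card + n := by
      have hB : ∑ k ∈ range T, baseCount b k n = ((range n).filter fun i => b i < T).card := by
        unfold baseCount
        rw [← Finset.card_biUnion]
        · congr 1
          ext i
          simp
          tauto
        · intro k _ k' _ hkk
          rw [Function.onFun, Finset.disjoint_filter]
          rintro i _ h1 h2
          exact hkk (h1.symm.trans h2)
      have hC : ∑ k ∈ range T, ((range n).filter fun i => b i = k ∧ e i = j).card =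
          ((range n).filter fun i => e i = j ∧ b i < T).card := by
        rw [← Finset.card_biUnion]
        · congr 1
          ext i
          simp
          tauto
        · intro k _ k' _ hkk
          rw [Function.onFun, Finset.disjoint_filter]
          rintro i _ ⟨h1, _⟩ ⟨h2, _⟩
          exact hkk (h1.symm.trans h2)
      rw [hB, hC, ← Finset.card_union_add_card_inter, ← Finset.filter_and, add_comm]
      gcongr
      exact (Finset.card_le_card (Finset.union_subset (Finset.filter_subset _ _)
        (Finset.filter_subset _ _))).trans_eq (Finset.card_range n)
    have h2 : (((range n).filter fun i => e i = j).card : ℝ) +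
        ∑ k ∈ range T, (baseCount b k n : ℝ) ≤
        ∑ k ∈ range T, (((range n).filter fun i => b i = k ∧ e i = j).card : ℝ) + n := by
      exact_mod_cast h1
    linarith
  have hlim := fun T : ℕ => tendsto_finsetSum (range T) fun k _ => hJ' k
  have hlimb := fun T : ℕ => tendsto_finsetSum (range T) fun k _ => hd k
  have hone : Tendsto (fun n : ℕ => (n : ℝ) / n) atTop (𝓝 1) :=
    tendsto_const_nhds.congr' (by
      filter_upwards [eventually_gt_atTop 0] with n hn
      rw [div_self]
      positivity)
  have hcol := (hP.2 j).tendsto_sum_nat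
  have hdt := hd1.tendsto_sum_nat
  refine tendsto_order.2 ⟨fun a ha => ?_, fun a ha => ?_⟩
  · obtain ⟨T, hT⟩ := (hcol.eventually (lt_mem_nhds ha)).exists
    filter_upwards [(hlim T).eventually (lt_mem_nhds hT)] with n hn
    exact hn.trans_le (hlow T n)
  · have h1 : Tendsto (fun T => ∑ k ∈ range T, (if 2 ≤ k then d k * P k j else 0) +
        (1 - ∑ k ∈ range T, d k)) atTop (𝓝 (α j + (1 - 1))) :=
      hcol.add (tendsto_const_nhds.sub hdt)
    rw [sub_self, add_zero] at h1
    obtain ⟨T, hT⟩ := (h1.eventually (gt_mem_nhds ha)).exists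
    filter_upwards [((hlim T).add (hone.sub (hlimb T))).eventually (gt_mem_nhds hT)] with n hn
    exact (hupp T n).trans_lt hn

theorem jointLevelSet_subset_levelSet {b : ℕ → ℕ} (hb : ∀ i, 2 ≤ b i) {d : ℕ → ℝ}
    (hd : IsBaseFrequency b d) (hd1 : HasSum d 1) {α : ℕ → ℝ} {P : ℕ → ℕ → ℝ}
    (hP : P ∈ admissible d α) : jointLevelSet b d P ⊆ levelSet b α := fun x hx =>
  ⟨hx.1, fun j => tendsto_digit_of_tendsto_joint hb hd hd1 hP (fun i => digit_lt hb x i) hx.2 j⟩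

/-! ### The matrix `P^α` is admissible -/

section Algebra

variable {d α : ℕ → ℝ}

theorem hasSum_sum_admissible {P : ℕ → ℕ → ℝ} (hP : P ∈ admissible d α) (k : ℕ) :
    HasSum (fun n => if 2 ≤ n then d n * ∑ j ∈ range k, P n j else 0) (∑ j ∈ range k, α j) := by
  have h := hasSum_sum (s := range k) fun j _ => hP.2 j
  convert! h using 2 with n
  split_ifs
  · rw [Finset.mul_sum]
  · simp

/-- Bases up to `k` only use digits below `k`; the rest of the mass of these digits is available
for the bases in `s`. -/
theorem sum_range_add_sum_le (hd0 : ∀ n, 0 ≤ d n) (hd2 : ∀ n < 2, d n = 0)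
    {P : ℕ → ℕ → ℝ} (hP : P ∈ admissible d α) (k : ℕ) (s : Finset ℕ) (hs : ∀ n ∈ s, k < n) :
    ∑ n ∈ range (k + 1), d n + ∑ n ∈ s, d n * ∑ j ∈ range k, P n j ≤ ∑ j ∈ range k, α j := by
  have h := hasSum_sum_admissible hP k
  have hdisj : Disjoint (range (k + 1)) s := by
    rw [Finset.disjoint_left]
    intro n hn hn'
    have := hs n hn'
    simp at hn
    omega
  refine le_trans (le_of_eq ?_) (sum_le_hasSum (range (k + 1) ∪ s) (fun n _ => ?_) h)
  · rw [Finset.sum_union hdisj]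
    congr 1
    · refine Finset.sum_congr rfl fun n hn => ?_
      split_ifs with h2
      · have h3 : ∑ j ∈ range k, P n j = ∑ j ∈ range n, P n j := by
          symm
          refine Finset.sum_subset (fun j hj => ?_) fun j _ hj => (hP.1 n h2).2.1 j (by simpa using hj)
          simp at hj hn ⊢
          omega
        rw [h3, (hP.1 n h2).2.2, mul_one]
      · exact hd2 n (by omega)
    · refine Finset.sum_congr rfl fun n hn => ?_
      split_ifs with h2
      · rfl
      · rw [hd2 n (by omega), zero_mul]
  · split_ifs with h2
    · exact mul_nonneg (hd0 n) (Finset.sum_nonneg fun j _ => (hP.1 n h2).1 j)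
    · exact le_rfl

theorem eq_zero_of_lt_jMin {j : ℕ} (hj : j < jMin α) : α j = 0 := by
  by_contra h
  exact Nat.notMem_of_lt_sInf hj h

/-- A Hall-type condition: bases at most `k` draw all their digits from below `k`. It is all that
the admissibility of `P^α` needs from `π(α) ≠ ∅`. -/
theorem sum_range_le_sum_range (hd0 : ∀ n, 0 ≤ d n) (hd2 : ∀ n < 2, d n = 0)
    (hne : (admissible d α).Nonempty) (k : ℕ) :
    ∑ n ∈ range (k + 1), d n ≤ ∑ j ∈ range k, α j := by
  obtain ⟨P, hP⟩ := hne
  simpa using sum_range_add_sum_le hd0 hd2 hP k ∅ (by simp)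

theorem baseFrequency_eq_zero_of_le_jMin (hd0 : ∀ n, 0 ≤ d n) (hd2 : ∀ n < 2, d n = 0)
    (hne : (admissible d α).Nonempty) {n : ℕ} (hn : n ≤ jMin α) : d n = 0 := by
  have h := sum_range_le_sum_range hd0 hd2 hne (jMin α)
  rw [Finset.sum_eq_zero (s := range (jMin α)) fun j hj => eq_zero_of_lt_jMin (by simpa using hj)]
    at h
  exact le_antisymm ((Finset.single_le_sum (fun i _ => hd0 i)
    (Finset.mem_range.2 (Nat.lt_succ_of_le hn))).trans h) (hd0 n)

/-- The added terms vanish, by minimality of `j₀` and because bases at most `j₀` could only use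
digits of frequency zero. This removes `j₀` from the later computations. -/
theorem massA_eq (hd0 : ∀ n, 0 ≤ d n) (hd2 : ∀ n < 2, d n = 0)
    (hne : (admissible d α).Nonempty) (n : ℕ) :
    massA d α n = ∑ j ∈ range n, α j - ∑ k ∈ range n, d k := by
  unfold massA
  congr 1
  · refine Finset.sum_subset (fun j hj => ?_) fun j hj hj' => eq_zero_of_lt_jMin ?_
    · simp at hj ⊢
      omega
    · simp at hj hj'
      omega
  · refine Finset.sum_subset (fun j hj => ?_) fun j hj hj' =>
      baseFrequency_eq_zero_of_le_jMin hd0 hd2 hne ?_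
    · simp at hj ⊢
      omega
    · simp at hj hj'
      omega

theorem le_massA (hd0 : ∀ n, 0 ≤ d n) (hd2 : ∀ n < 2, d n = 0)
    (hne : (admissible d α).Nonempty) (n : ℕ) : d n ≤ massA d α n := by
  have h := sum_range_le_sum_range hd0 hd2 hne n
  rw [massA_eq hd0 hd2 hne]
  rw [Finset.sum_range_succ] at h
  linarith

theorem massA_nonneg (hd0 : ∀ n, 0 ≤ d n) (hd2 : ∀ n < 2, d n = 0)
    (hne : (admissible d α).Nonempty) (n : ℕ) : 0 ≤ massA d α n :=
  (hd0 n).trans (le_massA hd0 hd2 hne n)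

theorem massA_succ (hd0 : ∀ n, 0 ≤ d n) (hd2 : ∀ n < 2, d n = 0)
    (hne : (admissible d α).Nonempty) (n : ℕ) :
    massA d α (n + 1) = massA d α n - d n + α n := by
  rw [massA_eq hd0 hd2 hne, massA_eq hd0 hd2 hne, Finset.sum_range_succ, Finset.sum_range_succ]
  ring

theorem massA_mul_factor (hd0 : ∀ n, 0 ≤ d n) (hd2 : ∀ n < 2, d n = 0)
    (hne : (admissible d α).Nonempty) (n : ℕ) :
    massA d α n * factor d α n = massA d α n - d n := by
  unfold factor
  by_cases h : massA d α n = 0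
  -- With `A_n = 0` the factor is `1` by division by zero, and `d n ≤ A_n` forces `d n = 0`.
  · have h1 := le_massA hd0 hd2 hne n
    have h2 := hd0 n
    rw [h] at h1 ⊢
    linarith
  · field_simp

theorem factor_nonneg (hd0 : ∀ n, 0 ≤ d n) (hd2 : ∀ n < 2, d n = 0)
    (hne : (admissible d α).Nonempty) (n : ℕ) : 0 ≤ factor d α n :=
  sub_nonneg.2 (div_le_one_of_le₀ (le_massA hd0 hd2 hne n) (massA_nonneg hd0 hd2 hne n))

theorem factor_le_one (hd0 : ∀ n, 0 ≤ d n) (hd2 : ∀ n < 2, d n = 0)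
    (hne : (admissible d α).Nonempty) (n : ℕ) : factor d α n ≤ 1 :=
  sub_le_self _ (div_nonneg (hd0 n) (massA_nonneg hd0 hd2 hne n))

theorem massA_le_one (hα : IsStochastic α) (hd0 : ∀ n, 0 ≤ d n) (hd2 : ∀ n < 2, d n = 0)
    (hne : (admissible d α).Nonempty) (n : ℕ) : massA d α n ≤ 1 := by
  rw [massA_eq hd0 hd2 hne]
  have h1 := sum_le_hasSum (range n) (fun j _ => hα.1 j) hα.2
  have h2 := Finset.sum_nonneg (s := range n) fun k _ => hd0 k
  linarith

theorem tendsto_massA (hα : IsStochastic α) (hd0 : ∀ n, 0 ≤ d n) (hd2 : ∀ n < 2, d n = 0)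
    (hd1 : HasSum d 1) (hne : (admissible d α).Nonempty) :
    Tendsto (massA d α) atTop (𝓝 0) := by
  have h := hα.2.tendsto_sum_nat.sub hd1.tendsto_sum_nat
  rw [sub_self] at h
  exact h.congr fun n => (massA_eq hd0 hd2 hne n).symm

/-- The part of the mass of the digit `j` which is not used by the bases below `n`. -/
noncomputable def remaining (d α : ℕ → ℝ) (j n : ℕ) : ℝ :=
  α j * ∏ k ∈ Finset.Ico (j + 1) n, factor d α k

theorem remaining_succ {j n : ℕ} (h : j < n) :
    remaining d α j (n + 1) = remaining d α j n * factor d α n := by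
  rw [remaining, remaining, Finset.prod_Ico_succ_top (by omega), mul_assoc]

theorem remaining_self_succ (j : ℕ) : remaining d α j (j + 1) = α j := by
  simp [remaining]

theorem remaining_nonneg (hα : IsStochastic α) (hd0 : ∀ n, 0 ≤ d n) (hd2 : ∀ n < 2, d n = 0)
    (hne : (admissible d α).Nonempty) (j n : ℕ) : 0 ≤ remaining d α j n :=
  mul_nonneg (hα.1 j) (Finset.prod_nonneg fun k _ => factor_nonneg hd0 hd2 hne k)

/-- Base `n` multiplies all remaining masses by the same factor and so lowers their sum from `A_n`
to `A_n - d n`; then the digit `n` becomes available and adds `α n`. This makes the rows of `P^α`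
stochastic. -/
theorem sum_remaining (hd0 : ∀ n, 0 ≤ d n) (hd2 : ∀ n < 2, d n = 0)
    (hne : (admissible d α).Nonempty) (n : ℕ) :
    ∑ j ∈ range n, remaining d α j n = massA d α n := by
  induction n with
  | zero => simp [massA]
  | succ n ih =>
    rw [Finset.sum_range_succ, remaining_self_succ, massA_succ hd0 hd2 hne,
      ← massA_mul_factor hd0 hd2 hne, ← ih, Finset.sum_mul]
    congr 1
    exact Finset.sum_congr rfl fun j hj => remaining_succ (Finset.mem_range.1 hj)

theorem tendsto_remaining (hα : IsStochastic α) (hd0 : ∀ n, 0 ≤ d n) (hd2 : ∀ n < 2, d n = 0)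
    (hd1 : HasSum d 1) (hne : (admissible d α).Nonempty) (j : ℕ) :
    Tendsto (remaining d α j) atTop (𝓝 0) := by
  refine tendsto_of_tendsto_of_tendsto_of_le_of_le' tendsto_const_nhds
    (tendsto_massA hα hd0 hd2 hd1 hne)
    (Eventually.of_forall fun n => remaining_nonneg hα hd0 hd2 hne j n) ?_
  filter_upwards [eventually_gt_atTop j] with n hn
  rw [← sum_remaining hd0 hd2 hne n]
  exact Finset.single_le_sum (f := fun j => remaining d α j n)
    (fun i _ => remaining_nonneg hα hd0 hd2 hne i n) (Finset.mem_range.2 hn)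

theorem optMatrix_eq {n j : ℕ} (hn : jMin α < n ∧ massA d α n ≠ 0) (hj : j < n) :
    optMatrix d α n j = remaining d α j n / massA d α n := by
  rw [optMatrix, if_pos hn]
  split_ifs with h
  · rw [remaining]
    ring
  · rw [remaining, eq_zero_of_lt_jMin (by omega : j < jMin α)]
    simp

theorem optMatrix_of_le {n j : ℕ} (h : n ≤ j) : optMatrix d α n j = 0 := by
  unfold optMatrix
  split_ifs <;> first | omega | rfl

theorem optMatrix_eq_mul {n j : ℕ} (hj : jMin α ≤ j) (hjn : j < n) (hA : massA d α n ≠ 0)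
    (ht : ∏ k ∈ Finset.Icc (jMin α + 1) j, factor d α k ≠ 0) :
    optMatrix d α n j = rSeq d α n * tSeq d α j := by
  rw [optMatrix_eq ⟨by omega, hA⟩ hjn, remaining, rSeq, tSeq]
  have : ∏ k ∈ Finset.Ico (jMin α + 1) n, factor d α k =
      (∏ k ∈ Finset.Icc (jMin α + 1) j, factor d α k) *
        ∏ k ∈ Finset.Ico (j + 1) n, factor d α k := by
    rw [← Finset.prod_Ico_consecutive _ (by omega : jMin α + 1 ≤ j + 1) (by omega : j + 1 ≤ n)]
    rfl
  rw [this]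
  field_simp

theorem baseFrequency_eq_zero_of_not (hd0 : ∀ n, 0 ≤ d n) (hd2 : ∀ n < 2, d n = 0)
    (hne : (admissible d α).Nonempty) {n : ℕ} (hn : ¬ (jMin α < n ∧ massA d α n ≠ 0)) :
    d n = 0 := by
  by_cases h : jMin α < n
  · have hA : massA d α n = 0 := by
      by_contra hA
      exact hn ⟨h, hA⟩
    exact le_antisymm (hA ▸ le_massA hd0 hd2 hne n) (hd0 n)
  · exact baseFrequency_eq_zero_of_le_jMin hd0 hd2 hne (by omega)

theorem optMatrix_mem_stochMatrices (hα : IsStochastic α) (hd0 : ∀ n, 0 ≤ d n)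
    (hd2 : ∀ n < 2, d n = 0) (hne : (admissible d α).Nonempty) :
    optMatrix d α ∈ stochMatrices := by
  intro n hn
  by_cases h : jMin α < n ∧ massA d α n ≠ 0
  · refine ⟨fun j => ?_, fun j hj => optMatrix_of_le hj, ?_⟩
    · rcases lt_or_ge j n with hj | hj
      · rw [optMatrix_eq h hj]
        exact div_nonneg (remaining_nonneg hα hd0 hd2 hne j n) (massA_nonneg hd0 hd2 hne n)
      · rw [optMatrix_of_le hj]
    · rw [Finset.sum_congr rfl fun j hj => optMatrix_eq h (Finset.mem_range.1 hj),
        ← Finset.sum_div, sum_remaining hd0 hd2 hne, div_self h.2]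
  · have h1 : ∀ j, optMatrix d α n j = if j < n then 1 / (n : ℝ) else 0 := fun j => by
      rw [optMatrix, if_neg h]
    refine ⟨fun j => ?_, fun j hj => optMatrix_of_le hj, ?_⟩
    · rw [h1]
      split_ifs <;> positivity
    · rw [Finset.sum_congr rfl fun j hj => (h1 j).trans (if_pos (Finset.mem_range.1 hj))]
      rw [Finset.sum_const, Finset.card_range, nsmul_eq_mul]
      have : (n : ℝ) ≠ 0 := by
        have : n ≠ 0 := by omega
        exact_mod_cast this
      field_simp

/-- The telescoping behind the column sums: what base `n` takes from digit `j` is the drop in the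
remaining mass. Rows outside the formula cause no harm because there `d n = 0`. -/
theorem baseFrequency_mul_optMatrix (hd0 : ∀ n, 0 ≤ d n) (hd2 : ∀ n < 2, d n = 0)
    (hne : (admissible d α).Nonempty) {n j : ℕ} (hj : j < n) :
    d n * optMatrix d α n j = remaining d α j n - remaining d α j (n + 1) := by
  rw [remaining_succ hj]
  by_cases h : jMin α < n ∧ massA d α n ≠ 0
  · rw [optMatrix_eq h hj, factor]
    ring
  · rw [factor, baseFrequency_eq_zero_of_not hd0 hd2 hne h]
    simp

theorem sum_Ico_baseFrequency_mul_optMatrix (hd0 : ∀ n, 0 ≤ d n) (hd2 : ∀ n < 2, d n = 0)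
    (hne : (admissible d α).Nonempty) {j k N : ℕ} (hk : j < k) (hN : k ≤ N) :
    ∑ n ∈ Finset.Ico k N, d n * optMatrix d α n j =
      remaining d α j k - remaining d α j N := by
  induction N, hN using Nat.le_induction with
  | base => simp
  | succ N hN ih =>
    rw [Finset.sum_Ico_succ_top hN, ih, baseFrequency_mul_optMatrix hd0 hd2 hne (by omega)]
    ring

theorem optMatrix_mem_admissible (hα : IsStochastic α) (hd0 : ∀ n, 0 ≤ d n)
    (hd2 : ∀ n < 2, d n = 0) (hd1 : HasSum d 1) (hne : (admissible d α).Nonempty) :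
    optMatrix d α ∈ admissible d α := by
  have hS := optMatrix_mem_stochMatrices hα hd0 hd2 hne
  refine ⟨hS, fun j => ?_⟩
  rw [hasSum_iff_tendsto_nat_of_nonneg]
  · have h : Tendsto (fun N => α j - remaining d α j N) atTop (𝓝 (α j - 0)) :=
      tendsto_const_nhds.sub (tendsto_remaining hα hd0 hd2 hd1 hne j)
    rw [sub_zero] at h
    refine h.congr' ?_
    filter_upwards [eventually_gt_atTop j] with N hN
    rw [← remaining_self_succ (d := d) (α := α) j,
      ← sum_Ico_baseFrequency_mul_optMatrix hd0 hd2 hne (Nat.lt_succ_self j) hN]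
    have : ∀ n, (if 2 ≤ n then d n * optMatrix d α n j else 0) = d n * optMatrix d α n j := by
      intro n
      split_ifs with h
      · rfl
      · rw [hd2 n (by omega), zero_mul]
    simp_rw [this]
    refine Finset.sum_subset (fun n hn => ?_) fun n hn hn' => ?_
    · simp at hn ⊢
      omega
    · rw [optMatrix_of_le, mul_zero]
      simp at hn hn'
      omega
  · intro n
    split_ifs with h
    · exact mul_nonneg (hd0 n) ((hS n h).1 j)
    · exact le_rfl

end Algebra

/-! ### Entropy -/

/-- The entropy of the `n`-th row of `P`. -/
noncomputable def rowEntropy (P : ℕ → ℕ → ℝ) (n : ℕ) : ℝ :=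
  ∑ j ∈ range n, Real.negMulLog (P n j)

/-- Gibbs' inequality, from `log x ≤ x - 1` at `x = q j / p j`. The support condition is needed
because `Real.log 0 = 0`. -/
theorem sum_negMulLog_le {ι : Type*} {s : Finset ι} {p q : ι → ℝ} (hp : ∀ j ∈ s, 0 ≤ p j)
    (hq : ∀ j ∈ s, 0 ≤ q j) (hpq : ∀ j ∈ s, p j ≠ 0 → q j ≠ 0) (hp1 : ∑ j ∈ s, p j = 1)
    (hq1 : ∑ j ∈ s, q j ≤ 1) :
    ∑ j ∈ s, Real.negMulLog (p j) ≤ ∑ j ∈ s, p j * -Real.log (q j) := by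
  have h : ∀ j ∈ s, Real.negMulLog (p j) - p j * -Real.log (q j) ≤ q j - p j := by
    intro j hj
    by_cases h0 : p j = 0
    · simp [h0, hq j hj]
    · have hp0 : 0 < p j := lt_of_le_of_ne (hp j hj) (Ne.symm h0)
      have hq0 : 0 < q j := lt_of_le_of_ne (hq j hj) (Ne.symm (hpq j hj h0))
      have h1 := Real.log_le_sub_one_of_pos (div_pos hq0 hp0)
      rw [Real.log_div hq0.ne' hp0.ne'] at h1
      have h2 := mul_le_mul_of_nonneg_left h1 hp0.le
      have h3 : p j * (q j / p j - 1) = q j - p j := by field_simp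
      rw [h3] at h2
      rw [Real.negMulLog]
      linarith
  have := Finset.sum_le_sum h
  rw [Finset.sum_sub_distrib, Finset.sum_sub_distrib] at this
  linarith

theorem stochMatrices_le_one {P : ℕ → ℕ → ℝ} (hP : P ∈ stochMatrices) {n : ℕ} (hn : 2 ≤ n)
    (j : ℕ) : P n j ≤ 1 := by
  rcases lt_or_ge j n with hj | hj
  · rw [← (hP n hn).2.2]
    exact Finset.single_le_sum (fun i _ => (hP n hn).1 i) (Finset.mem_range.2 hj)
  · rw [(hP n hn).2.1 j hj]
    exact zero_le_one

theorem rowEntropy_nonneg {P : ℕ → ℕ → ℝ} (hP : P ∈ stochMatrices) {n : ℕ} (hn : 2 ≤ n) :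
    0 ≤ rowEntropy P n :=
  Finset.sum_nonneg fun j _ =>
    Real.negMulLog_nonneg ((hP n hn).1 j) (stochMatrices_le_one hP hn j)

theorem rowEntropy_le_log {P : ℕ → ℕ → ℝ} (hP : P ∈ stochMatrices) {n : ℕ} (hn : 2 ≤ n) :
    rowEntropy P n ≤ Real.log n := by
  have hn0 : (n : ℝ) ≠ 0 := by
    have : n ≠ 0 := by omega
    exact_mod_cast this
  refine (sum_negMulLog_le (q := fun _ => (n : ℝ)⁻¹) (fun j _ => (hP n hn).1 j)
    (fun _ _ => by positivity) (fun _ _ _ => inv_ne_zero hn0) (hP n hn).2.2 ?_).trans_eq ?_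
  · simp [hn0]
  · rw [← Finset.sum_mul, (hP n hn).2.2, one_mul, Real.log_inv, neg_neg]

/-! ### The logarithmic loss and the maximality of `P^α` -/

section Loss

variable {d α : ℕ → ℝ}

theorem mul_rowEntropy_nonneg (hd0 : ∀ n, 0 ≤ d n) (hd2 : ∀ n < 2, d n = 0) {P : ℕ → ℕ → ℝ}
    (hP : P ∈ stochMatrices) (n : ℕ) : 0 ≤ d n * rowEntropy P n := by
  rcases lt_or_ge n 2 with hn | hn
  · rw [hd2 n hn, zero_mul]
  · exact mul_nonneg (hd0 n) (rowEntropy_nonneg hP hn)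

theorem mul_rowEntropy_le (hd0 : ∀ n, 0 ≤ d n) (hd2 : ∀ n < 2, d n = 0) {P : ℕ → ℕ → ℝ}
    (hP : P ∈ stochMatrices) (n : ℕ) : d n * rowEntropy P n ≤ d n * Real.log n := by
  rcases lt_or_ge n 2 with hn | hn
  · rw [hd2 n hn, zero_mul, zero_mul]
  · exact mul_le_mul_of_nonneg_left (rowEntropy_le_log hP hn) (hd0 n)

theorem summable_mul_rowEntropy (hd0 : ∀ n, 0 ≤ d n) (hd2 : ∀ n < 2, d n = 0)
    {P : ℕ → ℕ → ℝ} (hP : P ∈ stochMatrices) (hs : Summable fun n : ℕ => d n * Real.log n) :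
    Summable fun n => d n * rowEntropy P n :=
  Summable.of_nonneg_of_le (mul_rowEntropy_nonneg hd0 hd2 hP) (mul_rowEntropy_le hd0 hd2 hP) hs

/-- The logarithmic loss `-log p^α_{n,j}`, split into a part depending on the digit, a part
depending on the base, and parts depending on the pairs `j < k < n`. -/
noncomputable def logLoss (d α : ℕ → ℝ) (n j : ℕ) : ℝ :=
  -Real.log (α j) + Real.log (massA d α n) +
    ∑ k ∈ Finset.Ico (j + 1) n, -Real.log (factor d α k)

theorem neg_log_optMatrix {n j : ℕ} (hn : jMin α < n ∧ massA d α n ≠ 0) (hj : j < n)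
    (h0 : optMatrix d α n j ≠ 0) : -Real.log (optMatrix d α n j) = logLoss d α n j := by
  rw [optMatrix_eq hn hj] at h0 ⊢
  have h1 : remaining d α j n ≠ 0 := fun h => h0 (by rw [h, zero_div])
  have h2 := h1
  rw [remaining] at h2
  have h3 := right_ne_zero_of_mul h2
  rw [Real.log_div h1 hn.2, remaining, Real.log_mul (left_ne_zero_of_mul h2) h3,
    Real.log_prod (fun k hk => Finset.prod_ne_zero_iff.1 h3 k hk), logLoss,
    Finset.sum_neg_distrib]
  ring

/-- Rearranged in this way, `μ` enters only through column sums, row sums and the masses of the sets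
`j < k < n`. For a coupling of `d` and `α` all three are determined by the marginals, up to
truncation. The statement is for general `μ` so that it serves both for matrices and for empirical
counts. -/
theorem sum_mul_logLoss (μ : ℕ → ℕ → ℝ) (T : ℕ) :
    ∑ n ∈ range T, ∑ j ∈ range n, μ n j * logLoss d α n j =
      ∑ j ∈ range T, -Real.log (α j) * ∑ n ∈ Finset.Ico (j + 1) T, μ n j +
      ∑ n ∈ range T, Real.log (massA d α n) * ∑ j ∈ range n, μ n j +
      ∑ k ∈ range T, -Real.log (factor d α k) *
        ∑ n ∈ Finset.Ico (k + 1) T, ∑ j ∈ range k, μ n j := by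
  simp_rw [logLoss, mul_add, Finset.sum_add_distrib]
  congr 1
  · congr 1
    · rw [Finset.sum_comm' (t' := range T) (s' := fun j => Finset.Ico (j + 1) T)]
      · refine Finset.sum_congr rfl fun j _ => ?_
        rw [Finset.mul_sum]
        exact Finset.sum_congr rfl fun n _ => mul_comm _ _
      · intro n j
        simp
        omega
    · refine Finset.sum_congr rfl fun n _ => ?_
      rw [Finset.mul_sum]
      exact Finset.sum_congr rfl fun j _ => mul_comm _ _
  · have h1 : ∀ n, ∑ j ∈ range n, μ n j * ∑ k ∈ Finset.Ico (j + 1) n, -Real.log (factor d α k) =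
        ∑ k ∈ range n, ∑ j ∈ range k, -Real.log (factor d α k) * μ n j := by
      intro n
      simp_rw [Finset.mul_sum]
      rw [Finset.sum_comm' (t' := range n) (s' := fun k => range k)]
      · exact Finset.sum_congr rfl fun k _ => Finset.sum_congr rfl fun j _ => mul_comm _ _
      · intro j k
        simp
        omega
    simp_rw [h1, Finset.mul_sum]
    refine Finset.sum_comm' fun n k => ?_
    simp
    omega

theorem neg_log_nonneg_of_isStochastic (hα : IsStochastic α) (j : ℕ) : 0 ≤ -Real.log (α j) :=
  neg_nonneg.2 (Real.log_nonpos (hα.1 j) (le_hasSum hα.2 j fun i _ => hα.1 i))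

theorem neg_log_factor_nonneg (hd0 : ∀ n, 0 ≤ d n) (hd2 : ∀ n < 2, d n = 0)
    (hne : (admissible d α).Nonempty) (n : ℕ) : 0 ≤ -Real.log (factor d α n) :=
  neg_nonneg.2 (Real.log_nonpos (factor_nonneg hd0 hd2 hne n) (factor_le_one hd0 hd2 hne n))

theorem neg_log_massA_nonneg (hα : IsStochastic α) (hd0 : ∀ n, 0 ≤ d n)
    (hd2 : ∀ n < 2, d n = 0) (hne : (admissible d α).Nonempty) (n : ℕ) :
    0 ≤ -Real.log (massA d α n) :=
  neg_nonneg.2 (Real.log_nonpos (massA_nonneg hd0 hd2 hne n) (massA_le_one hα hd0 hd2 hne n))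

/-- The value of the truncated loss for marginals `α` and `d`. -/
noncomputable def lossBound (d α : ℕ → ℝ) (T : ℕ) : ℝ :=
  ∑ j ∈ range T, -Real.log (α j) * α j +
    ∑ n ∈ range T, Real.log (massA d α n) * d n +
    ∑ k ∈ range T, -Real.log (factor d α k) * (massA d α k - d k)

/-- The truncated column sums and pair masses are too small, but their coefficients are nonnegative.
The coefficients `log A_n` are nonpositive, and there the row sums are exact. -/
theorem sum_mul_logLoss_le (hα : IsStochastic α) (hd0 : ∀ n, 0 ≤ d n)
    (hd2 : ∀ n < 2, d n = 0) (hne : (admissible d α).Nonempty) {P : ℕ → ℕ → ℝ}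
    (hP : P ∈ admissible d α) (T : ℕ) :
    ∑ n ∈ range T, ∑ j ∈ range n, d n * P n j * logLoss d α n j ≤ lossBound d α T := by
  rw [sum_mul_logLoss (fun n j => d n * P n j), lossBound]
  refine add_le_add (add_le_add ?_ (le_of_eq ?_)) ?_
  · refine Finset.sum_le_sum fun j _ =>
      mul_le_mul_of_nonneg_left ?_ (neg_log_nonneg_of_isStochastic hα j)
    refine le_trans (le_of_eq ?_) (sum_le_hasSum (Finset.Ico (j + 1) T) (fun n _ => ?_) (hP.2 j))
    · refine Finset.sum_congr rfl fun n _ => ?_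
      split_ifs with h
      · rfl
      · rw [hd2 n (by omega), zero_mul]
    · split_ifs with h
      · exact mul_nonneg (hd0 n) ((hP.1 n h).1 j)
      · exact le_rfl
  · refine Finset.sum_congr rfl fun n _ => ?_
    rw [← Finset.mul_sum]
    rcases lt_or_ge n 2 with h | h
    · rw [hd2 n h, zero_mul]
    · rw [(hP.1 n h).2.2, mul_one]
  · refine Finset.sum_le_sum fun k _ =>
      mul_le_mul_of_nonneg_left ?_ (neg_log_factor_nonneg hd0 hd2 hne k)
    have h := sum_range_add_sum_le hd0 hd2 hP k (Finset.Ico (k + 1) T) fun n hn => by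
      simp at hn
      omega
    simp_rw [← Finset.mul_sum]
    rw [massA_eq hd0 hd2 hne]
    rw [Finset.sum_range_succ] at h
    linarith

/-- Where `P^α` vanishes, all admissible matrices vanish. -/
theorem optMatrix_ne_zero (hd0 : ∀ n, 0 ≤ d n)
    (hd2 : ∀ n < 2, d n = 0) (hne : (admissible d α).Nonempty) {P : ℕ → ℕ → ℝ}
    (hP : P ∈ admissible d α) {n j : ℕ} (hj : j < n) (hdn : d n ≠ 0) (h : P n j ≠ 0) :
    optMatrix d α n j ≠ 0 := by
  have hn2 : 2 ≤ n := by
    by_contra h2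
    exact hdn (hd2 n (by omega))
  have hgood : jMin α < n ∧ massA d α n ≠ 0 := by
    by_contra hb
    exact hdn (baseFrequency_eq_zero_of_not hd0 hd2 hne hb)
  have hpos : 0 < d n * P n j :=
    mul_pos (lt_of_le_of_ne (hd0 n) (Ne.symm hdn)) (lt_of_le_of_ne ((hP.1 n hn2).1 j) (Ne.symm h))
  rw [optMatrix_eq hgood hj]
  refine div_ne_zero (mul_ne_zero ?_ (Finset.prod_ne_zero_iff.2 fun k hk => ?_)) hgood.2
  · have h1 := le_hasSum (hP.2 j) n fun i _ => by
      split_ifs with hi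
      · exact mul_nonneg (hd0 i) ((hP.1 i hi).1 j)
      · exact le_rfl
    rw [if_pos hn2] at h1
    exact (hpos.trans_le h1).ne'
  · rw [Finset.mem_Ico] at hk
    -- A vanishing factor at `k` means `A_k = d k`: bases at most `k` exhaust the digits below `k`,
    -- leaving nothing for the base `n > k`.
    have h1 := sum_range_add_sum_le hd0 hd2 hP k {n} (by simpa using hk.2)
    rw [Finset.sum_singleton] at h1
    have h2 : d n * P n j ≤ d n * ∑ i ∈ range k, P n i :=
      mul_le_mul_of_nonneg_left (Finset.single_le_sum (fun i _ => (hP.1 n hn2).1 i)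
        (Finset.mem_range.2 (by omega))) (hd0 n)
    have h3 := massA_eq hd0 hd2 hne k
    rw [Finset.sum_range_succ] at h1
    intro h0
    have h4 := massA_mul_factor hd0 hd2 hne k
    rw [h0, mul_zero] at h4
    linarith

theorem mul_optMatrix_mul_logLoss (hd0 : ∀ n, 0 ≤ d n)
    (hd2 : ∀ n < 2, d n = 0) (hne : (admissible d α).Nonempty) (n : ℕ) :
    ∑ j ∈ range n, d n * optMatrix d α n j * logLoss d α n j =
      d n * rowEntropy (optMatrix d α) n := by
  rw [rowEntropy, Finset.mul_sum]
  refine Finset.sum_congr rfl fun j hj => ?_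
  by_cases hdn : d n = 0
  · simp [hdn]
  by_cases h0 : optMatrix d α n j = 0
  · simp [h0]
  rw [← neg_log_optMatrix (by_contra fun hb =>
    hdn (baseFrequency_eq_zero_of_not hd0 hd2 hne hb)) (Finset.mem_range.1 hj) h0,
    Real.negMulLog]
  ring

theorem mul_rowEntropy_le_sum_logLoss (hα : IsStochastic α) (hd0 : ∀ n, 0 ≤ d n)
    (hd2 : ∀ n < 2, d n = 0) (hne : (admissible d α).Nonempty) {P : ℕ → ℕ → ℝ}
    (hP : P ∈ admissible d α) (n : ℕ) :
    d n * rowEntropy P n ≤ ∑ j ∈ range n, d n * P n j * logLoss d α n j := by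
  by_cases hdn : d n = 0
  · simp [hdn]
  have hn2 : 2 ≤ n := by
    by_contra h2
    exact hdn (hd2 n (by omega))
  have hS := optMatrix_mem_stochMatrices hα hd0 hd2 hne
  have h := sum_negMulLog_le (s := range n) (p := P n) (q := optMatrix d α n)
    (fun j _ => (hP.1 n hn2).1 j) (fun j _ => (hS n hn2).1 j)
    (fun j hj h => optMatrix_ne_zero hd0 hd2 hne hP (Finset.mem_range.1 hj) hdn h)
    (hP.1 n hn2).2.2 (hS n hn2).2.2.le
  refine (mul_le_mul_of_nonneg_left h (hd0 n)).trans_eq ?_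
  rw [Finset.mul_sum]
  refine Finset.sum_congr rfl fun j hj => ?_
  by_cases hp : P n j = 0
  · simp [hp]
  rw [neg_log_optMatrix (by_contra fun hb =>
    hdn (baseFrequency_eq_zero_of_not hd0 hd2 hne hb)) (Finset.mem_range.1 hj)
    (optMatrix_ne_zero hd0 hd2 hne hP (Finset.mem_range.1 hj) hdn hp)]
  ring

theorem sum_mul_rowEntropy_le_lossBound (hα : IsStochastic α) (hd0 : ∀ n, 0 ≤ d n)
    (hd2 : ∀ n < 2, d n = 0) (hne : (admissible d α).Nonempty) {P : ℕ → ℕ → ℝ}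
    (hP : P ∈ admissible d α) (T : ℕ) :
    ∑ n ∈ range T, d n * rowEntropy P n ≤ lossBound d α T :=
  (Finset.sum_le_sum fun n _ => mul_rowEntropy_le_sum_logLoss hα hd0 hd2 hne hP n).trans
    (sum_mul_logLoss_le hα hd0 hd2 hne hP T)

/-- Since `A_n ≥ d n`, it suffices to bound `-d n log (d n)`; comparison of `d n` with `1 / n ^ 2`
gives at most `2 d n log n + 1 / n ^ 2`. -/
theorem summable_mul_neg_log_massA (hα : IsStochastic α) (hd0 : ∀ n, 0 ≤ d n)
    (hd2 : ∀ n < 2, d n = 0) (hne : (admissible d α).Nonempty)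
    (hs : Summable fun n : ℕ => d n * Real.log n) :
    Summable fun n => -Real.log (massA d α n) * d n := by
  have hq : Summable fun n : ℕ => 1 / (n : ℝ) ^ 2 :=
    Real.summable_one_div_nat_pow.2 (by norm_num)
  refine Summable.of_nonneg_of_le
    (fun n => mul_nonneg (neg_log_massA_nonneg hα hd0 hd2 hne n) (hd0 n)) (fun n => ?_)
    ((hs.mul_left 2).add hq)
  by_cases hdn : d n = 0
  · simp only [hdn, mul_zero, zero_mul, zero_add]
    positivity
  have hpos : 0 < d n := lt_of_le_of_ne (hd0 n) (Ne.symm hdn)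
  have hn2 : 2 ≤ n := by
    by_contra h2
    exact hdn (hd2 n (by omega))
  have hn0 : (0 : ℝ) < n := by
    have : 0 < n := by omega
    exact_mod_cast this
  have h1 : Real.log (d n) ≤ Real.log (massA d α n) :=
    Real.log_le_log hpos (le_massA hd0 hd2 hne n)
  have h2 := Real.log_le_sub_one_of_pos (show 0 < 1 / (n : ℝ) ^ 2 / d n by positivity)
  rw [Real.log_div (by positivity) hpos.ne', Real.log_div one_ne_zero (by positivity),
    Real.log_pow, Real.log_one] at h2
  have h3 := mul_le_mul_of_nonneg_left h2 hpos.le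
  have h4 : d n * (1 / (n : ℝ) ^ 2 / d n - 1) = 1 / (n : ℝ) ^ 2 - d n := by
    field_simp
  rw [h4] at h3
  push_cast at h3
  have h5 := mul_le_mul_of_nonneg_left h1 hpos.le
  linarith

/-- The inequality opposite to `sum_mul_logLoss_le`, up to `ε`: for `P^α` the loss equals the
entropy, so truncation loses nothing in the limit. Since the part with `log A_n` has the other sign,
its separate summability is needed. -/
theorem eventually_lossBound_le (hα : IsStochastic α) (hd0 : ∀ n, 0 ≤ d n)
    (hd2 : ∀ n < 2, d n = 0) (hd1 : HasSum d 1) (hne : (admissible d α).Nonempty)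
    (hs : Summable fun n : ℕ => d n * Real.log n) {ε : ℝ} (hε : 0 < ε) :
    ∀ᶠ T in atTop, lossBound d α T ≤ ∑' n, d n * rowEntropy (optMatrix d α) n + ε := by
  have hS := optMatrix_mem_stochMatrices hα hd0 hd2 hne
  have hsA := summable_mul_neg_log_massA hα hd0 hd2 hne hs
  have hsE := summable_mul_rowEntropy hd0 hd2 hS hs
  set E := ∑' n, d n * rowEntropy (optMatrix d α) n with hE
  set S := ∑' n, -Real.log (massA d α n) * d n with hSdef
  -- The two nonnegative parts are bounded uniformly in `T`: with `T` fixed, the inner truncation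
  -- `N` tends to infinity, and the outer sums up to `T` are at most those up to `N`.
  have key : ∀ T, ∑ j ∈ range T, -Real.log (α j) * α j +
      ∑ k ∈ range T, -Real.log (factor d α k) * (massA d α k - d k) ≤ E + S := by
    intro T
    have hX : ∀ j, Tendsto (fun N => ∑ n ∈ Finset.Ico (j + 1) N, d n * optMatrix d α n j) atTop
        (𝓝 (α j)) := by
      intro j
      have h : Tendsto (fun N => α j - remaining d α j N) atTop (𝓝 (α j - 0)) :=
        tendsto_const_nhds.sub (tendsto_remaining hα hd0 hd2 hd1 hne j)
      rw [sub_zero] at h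
      refine h.congr' ?_
      filter_upwards [eventually_gt_atTop j] with N hN
      rw [sum_Ico_baseFrequency_mul_optMatrix hd0 hd2 hne (Nat.lt_succ_self j) hN,
        remaining_self_succ]
    have hY : ∀ k, Tendsto (fun N => ∑ n ∈ Finset.Ico (k + 1) N,
        ∑ j ∈ range k, d n * optMatrix d α n j) atTop (𝓝 (massA d α k - d k)) := by
      intro k
      have h : Tendsto (fun N => ∑ j ∈ range k, (remaining d α j (k + 1) - remaining d α j N))
          atTop (𝓝 (∑ j ∈ range k, (remaining d α j (k + 1) - 0))) :=
        tendsto_finsetSum _ fun j _ =>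
          tendsto_const_nhds.sub (tendsto_remaining hα hd0 hd2 hd1 hne j)
      have h2 : ∑ j ∈ range k, (remaining d α j (k + 1) - 0) = massA d α k - d k := by
        rw [← massA_mul_factor hd0 hd2 hne, ← sum_remaining hd0 hd2 hne, Finset.sum_mul]
        refine Finset.sum_congr rfl fun j hj => ?_
        rw [sub_zero, remaining_succ (Finset.mem_range.1 hj)]
      rw [h2] at h
      refine h.congr' ?_
      filter_upwards [eventually_gt_atTop k] with N hN
      rw [Finset.sum_comm]
      refine Finset.sum_congr rfl fun j hj => ?_
      have := Finset.mem_range.1 hj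
      rw [sum_Ico_baseFrequency_mul_optMatrix hd0 hd2 hne (by omega : j < k + 1) hN]
    have hlim := (tendsto_finsetSum (range T) fun j _ =>
        (hX j).const_mul (-Real.log (α j))).add
      (tendsto_finsetSum (range T) fun k _ => (hY k).const_mul (-Real.log (factor d α k)))
    refine le_of_tendsto hlim ?_
    filter_upwards [eventually_ge_atTop T] with N hN
    have h1 := sum_mul_logLoss (d := d) (α := α) (fun n j => d n * optMatrix d α n j) N
    have h2 : ∑ n ∈ range N, ∑ j ∈ range n, d n * optMatrix d α n j * logLoss d α n j ≤ E := by
      simp_rw [mul_optMatrix_mul_logLoss hd0 hd2 hne]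
      exact hsE.sum_le_tsum _ fun n _ => mul_rowEntropy_nonneg hd0 hd2 hS n
    have h3 : -∑ n ∈ range N, Real.log (massA d α n) *
        ∑ j ∈ range n, d n * optMatrix d α n j ≤ S := by
      rw [← Finset.sum_neg_distrib]
      refine le_trans (le_of_eq (Finset.sum_congr rfl fun n _ => ?_))
        (hsA.sum_le_tsum (range N) fun n _ =>
          mul_nonneg (neg_log_massA_nonneg hα hd0 hd2 hne n) (hd0 n))
      rw [← Finset.mul_sum]
      rcases lt_or_ge n 2 with h | h
      · rw [hd2 n h]
        simp
      · rw [(hS n h).2.2]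
        ring
    have hnn : ∀ n j, 0 ≤ d n * optMatrix d α n j := by
      intro n j
      rcases lt_or_ge n 2 with h | h
      · rw [hd2 n h, zero_mul]
      · exact mul_nonneg (hd0 n) ((hS n h).1 j)
    have hsub : range T ⊆ range N := Finset.range_subset_range.2 hN
    have h4 := Finset.sum_le_sum_of_subset_of_nonneg hsub (f := fun j => -Real.log (α j) *
        ∑ n ∈ Finset.Ico (j + 1) N, d n * optMatrix d α n j) fun j _ _ =>
      mul_nonneg (neg_log_nonneg_of_isStochastic hα j) (Finset.sum_nonneg fun n _ => hnn n j)
    have h5 := Finset.sum_le_sum_of_subset_of_nonneg hsub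
        (f := fun k => -Real.log (factor d α k) *
          ∑ n ∈ Finset.Ico (k + 1) N, ∑ j ∈ range k, d n * optMatrix d α n j) fun k _ _ =>
      mul_nonneg (neg_log_factor_nonneg hd0 hd2 hne k)
        (Finset.sum_nonneg fun n _ => Finset.sum_nonneg fun j _ => hnn n j)
    linarith
  have ht := hsA.hasSum.tendsto_sum_nat.eventually (lt_mem_nhds (sub_lt_self S hε))
  filter_upwards [ht] with T hT
  have h1 : ∑ n ∈ range T, Real.log (massA d α n) * d n =
      -∑ n ∈ range T, -Real.log (massA d α n) * d n := by
    rw [← Finset.sum_neg_distrib]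
    exact Finset.sum_congr rfl fun n _ => by ring
  have h2 := key T
  rw [lossBound, h1]
  linarith

/-- The matrix `P^α` maximizes the mean entropy. -/
theorem tsum_mul_rowEntropy_le (hα : IsStochastic α) (hd0 : ∀ n, 0 ≤ d n)
    (hd2 : ∀ n < 2, d n = 0) (hd1 : HasSum d 1) (hs : Summable fun n : ℕ => d n * Real.log n)
    {P : ℕ → ℕ → ℝ} (hP : P ∈ admissible d α) :
    ∑' n, d n * rowEntropy P n ≤ ∑' n, d n * rowEntropy (optMatrix d α) n := by
  have hne : (admissible d α).Nonempty := ⟨P, hP⟩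
  refine le_of_forall_pos_le_add fun ε hε => ?_
  refine le_of_tendsto (summable_mul_rowEntropy hd0 hd2 hP.1 hs).hasSum.tendsto_sum_nat ?_
  filter_upwards [eventually_lossBound_le hα hd0 hd2 hd1 hne hs hε] with T hT
  exact (sum_mul_rowEntropy_le_lossBound hα hd0 hd2 hne hP T).trans hT

theorem entropyQuotient_eq (hd2 : ∀ n < 2, d n = 0) (P : ℕ → ℕ → ℝ) :
    entropyQuotient d P = (∑' n, d n * rowEntropy P n) / ∑' n : ℕ, d n * Real.log n := by
  unfold entropyQuotient rowEntropy
  congr 1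
  · refine tsum_congr fun n => ?_
    split_ifs with h
    · simp only [Real.negMulLog, neg_mul, Finset.sum_neg_distrib, mul_neg]
    · rw [hd2 n (by omega), zero_mul]
  · refine tsum_congr fun n => ?_
    split_ifs with h
    · rfl
    · rw [hd2 n (by omega), zero_mul]

theorem tsum_mul_log_pos (hd0 : ∀ n, 0 ≤ d n) (hd2 : ∀ n < 2, d n = 0) (hd1 : HasSum d 1)
    (hs : Summable fun n : ℕ => d n * Real.log n) : 0 < ∑' n : ℕ, d n * Real.log n := by
  have h := hasSum_le (fun n => ?_) (hd1.mul_right (Real.log 2)) hs.hasSum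
  · rw [one_mul] at h
    exact (Real.log_pos one_lt_two).trans_le h
  · rcases lt_or_ge n 2 with hn | hn
    · simp [hd2 n hn]
    · exact mul_le_mul_of_nonneg_left
        (Real.log_le_log two_pos (by exact_mod_cast hn)) (hd0 n)

theorem isGreatest_entropyQuotient (hα : IsStochastic α) (hd0 : ∀ n, 0 ≤ d n)
    (hd2 : ∀ n < 2, d n = 0) (hd1 : HasSum d 1) (hne : (admissible d α).Nonempty)
    (hs : Summable fun n : ℕ => d n * Real.log n) :
    IsGreatest (entropyQuotient d '' admissible d α) (entropyQuotient d (optMatrix d α)) := by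
  refine ⟨⟨_, optMatrix_mem_admissible hα hd0 hd2 hd1 hne, rfl⟩, ?_⟩
  rintro _ ⟨P, hP, rfl⟩
  rw [entropyQuotient_eq hd2, entropyQuotient_eq hd2]
  exact div_le_div_of_nonneg_right (tsum_mul_rowEntropy_le hα hd0 hd2 hd1 hs hP)
    (tsum_mul_log_pos hd0 hd2 hd1 hs).le

end Loss

/-! ### Cantor series with given digits -/

section Expansion

variable {b : ℕ → ℕ}

/-- The number of cylinders of order `N`. -/
def baseProd (b : ℕ → ℕ) (N : ℕ) : ℕ := ∏ k ∈ range N, b k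

theorem baseProd_succ (b : ℕ → ℕ) (N : ℕ) : baseProd b (N + 1) = baseProd b N * b N :=
  Finset.prod_range_succ _ _

theorem baseProd_pos (hb : ∀ i, 2 ≤ b i) (N : ℕ) : (0 : ℝ) < baseProd b N := by
  exact_mod_cast Finset.prod_pos fun i _ => by have := hb i; omega

theorem two_pow_le_baseProd (hb : ∀ i, 2 ≤ b i) (N : ℕ) : (2 : ℝ) ^ N ≤ baseProd b N := by
  have : (2 : ℕ) ^ N ≤ ∏ k ∈ range N, b k := by
    simpa using Finset.pow_card_le_prod (range N) b 2 (fun i _ => hb i)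
  exact_mod_cast this

theorem tendsto_one_div_baseProd (hb : ∀ i, 2 ≤ b i) :
    Tendsto (fun N => 1 / (baseProd b N : ℝ)) atTop (𝓝 0) := by
  refine squeeze_zero (fun N => by positivity) (fun N => ?_)
    (tendsto_pow_atTop_nhds_zero_of_lt_one (r := (1 / 2 : ℝ)) (by norm_num) (by norm_num))
  rw [one_div_pow]
  exact one_div_le_one_div_of_le (by positivity) (two_pow_le_baseProd hb N)

theorem log_baseProd (hb : ∀ i, 2 ≤ b i) (N : ℕ) :
    Real.log (baseProd b N) = ∑ i ∈ range N, Real.log (b i) := by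
  rw [baseProd, Nat.cast_prod, Real.log_prod]
  intro i _
  have := hb i
  have : b i ≠ 0 := by omega
  exact_mod_cast this

/-- The sum of the Cantor series with digits `e`. -/
noncomputable def cantorValue (b e : ℕ → ℕ) : ℝ := ∑' i, (e i : ℝ) / baseProd b (i + 1)

theorem sum_Ico_digits_le (hb : ∀ i, 2 ≤ b i) {e : ℕ → ℕ} (he : ∀ i, e i < b i) {N n : ℕ}
    (hN : N ≤ n) : ∑ i ∈ Finset.Ico N n, (e i : ℝ) / baseProd b (i + 1) ≤
      1 / baseProd b N - 1 / baseProd b n := by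
  induction n, hN using Nat.le_induction with
  | base => simp
  | succ n hn ih =>
    rw [Finset.sum_Ico_succ_top hn]
    have h1 : (e n : ℝ) ≤ b n - 1 := by
      have : ((e n + 1 : ℕ) : ℝ) ≤ b n := by exact_mod_cast he n
      push_cast at this
      linarith
    have h2 := baseProd_pos hb n
    have h3 : (0 : ℝ) < b n := by
      have := hb n
      have : 0 < b n := by omega
      exact_mod_cast this
    have h4 : (e n : ℝ) / baseProd b (n + 1) ≤ 1 / baseProd b n - 1 / baseProd b (n + 1) := by
      rw [baseProd_succ]
      push_cast
      have : 1 / (baseProd b n : ℝ) - 1 / (baseProd b n * b n) =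
          (b n - 1) / (baseProd b n * b n) := by
        field_simp
      rw [this]
      gcongr
    linarith

theorem summable_digits (hb : ∀ i, 2 ≤ b i) {e : ℕ → ℕ} (he : ∀ i, e i < b i) :
    Summable fun i => (e i : ℝ) / baseProd b (i + 1) := by
  refine summable_of_sum_range_le (c := 1) (fun i => by positivity) fun n => ?_
  have h := sum_Ico_digits_le hb he (Nat.zero_le n)
  have h2 : (0 : ℝ) ≤ 1 / baseProd b n := by positivity
  rw [← Nat.Ico_zero_eq_range]
  have h3 : (baseProd b 0 : ℝ) = 1 := by simp [baseProd]
  rw [h3] at h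
  linarith

theorem sum_range_le_cantorValue (hb : ∀ i, 2 ≤ b i) {e : ℕ → ℕ} (he : ∀ i, e i < b i)
    (N : ℕ) : ∑ i ∈ range N, (e i : ℝ) / baseProd b (i + 1) ≤ cantorValue b e :=
  (summable_digits hb he).sum_le_tsum _ fun i _ => by positivity

theorem cantorValue_le (hb : ∀ i, 2 ≤ b i) {e : ℕ → ℕ} (he : ∀ i, e i < b i)
    (N : ℕ) : cantorValue b e ≤
      ∑ i ∈ range N, (e i : ℝ) / baseProd b (i + 1) + 1 / baseProd b N := by
  refine le_of_tendsto (summable_digits hb he).hasSum.tendsto_sum_nat ?_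
  filter_upwards [eventually_ge_atTop N] with n hn
  rw [← Finset.sum_range_add_sum_Ico _ hn]
  have := sum_Ico_digits_le hb he hn
  have h2 : (0 : ℝ) ≤ 1 / baseProd b n := by positivity
  linarith

theorem cantorValue_digit (hb : ∀ i, 2 ≤ b i) {x : ℝ} (hx : x ∈ Set.Icc (0 : ℝ) 1) :
    cantorValue b (digit b x) = x :=
  (hasSum_digit hb hx).tsum_eq

theorem abs_sub_le_of_digit_eq (hb : ∀ i, 2 ≤ b i) {x y : ℝ} (hx : x ∈ Set.Icc (0 : ℝ) 1)
    (hy : y ∈ Set.Icc (0 : ℝ) 1) {N : ℕ} (h : ∀ i < N, digit b x i = digit b y i) :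
    |x - y| ≤ 1 / baseProd b N := by
  have h1 := sum_range_le_cantorValue hb (digit_lt hb x) N
  have h2 := cantorValue_le hb (digit_lt hb x) N
  have h3 := sum_range_le_cantorValue hb (digit_lt hb y) N
  have h4 := cantorValue_le hb (digit_lt hb y) N
  rw [cantorValue_digit hb hx] at h1 h2
  rw [cantorValue_digit hb hy] at h3 h4
  rw [Finset.sum_congr rfl fun i hi => by rw [h i (Finset.mem_range.1 hi)]] at h1 h2
  rw [abs_le]
  constructor <;> linarith

end Expansion

/-! ### The upper bound -/

section Upper

variable {b : ℕ → ℕ}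

/-- If the points of `E` lie in cylinders of large weight, for infinitely many orders, then
there are few such cylinders. -/
theorem dimH_le_of_weight (hb : ∀ i, 2 ≤ b i) {E : Set ℝ} (hE : E ⊆ Set.Icc 0 1)
    {s : NNReal} {w : ℕ → ℕ → ℝ} (hw0 : ∀ i j, 0 ≤ w i j)
    (hw1 : ∀ i, ∑ j ∈ range (b i), w i j ≤ 1)
    (h : ∃ᶠ N in atTop, ∀ x ∈ E,
      (baseProd b N : ℝ) ^ (-(s : ℝ)) ≤ ∏ i ∈ range N, w i (digit b x i)) :
    dimH E ≤ s := by
  -- Covers along a subsequence of orders suffice, because Hausdorff measure is bounded by a liminf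
  -- over covers.
  obtain ⟨φ, hφ, hφE⟩ := Filter.extraction_of_frequently_atTop h
  refine dimH_le_of_hausdorffMeasure_ne_top (ne_top_of_le_ne_top ENNReal.one_ne_top ?_)
  set S : (n : ℕ) → Finset (Fin (φ n) → ℕ) := fun n =>
    (Fintype.piFinset fun i : Fin (φ n) => range (b i)).filter fun v =>
      (baseProd b (φ n) : ℝ) ^ (-(s : ℝ)) ≤ ∏ i : Fin (φ n), w i (v i) with hS
  set t : (n : ℕ) → S n → Set ℝ := fun n v => {x | x ∈ E ∧ ∀ i : Fin (φ n), digit b x i = v.1 i}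
    with ht
  have hr : Tendsto (fun n => ENNReal.ofReal (1 / baseProd b (φ n))) atTop (𝓝 0) := by
    rw [← ENNReal.ofReal_zero]
    exact ENNReal.tendsto_ofReal ((tendsto_one_div_baseProd hb).comp hφ.tendsto_atTop)
  have hdiam : ∀ n, ∀ v : S n,
      Metric.ediam (t n v) ≤ ENNReal.ofReal (1 / baseProd b (φ n)) := by
    intro n v
    refine Metric.ediam_le fun x hx y hy => ?_
    rw [edist_dist, Real.dist_eq]
    refine ENNReal.ofReal_le_ofReal (abs_sub_le_of_digit_eq hb (hE hx.1) (hE hy.1) fun i hi => ?_)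
    rw [hx.2 ⟨i, hi⟩, hy.2 ⟨i, hi⟩]
  have hcov : ∀ n, E ⊆ ⋃ v, t n v := by
    intro n x hx
    refine Set.mem_iUnion.2 ⟨⟨fun i => digit b x i, ?_⟩, hx, fun i => rfl⟩
    rw [hS, Finset.mem_filter, Fintype.mem_piFinset]
    refine ⟨fun i => Finset.mem_range.2 (digit_lt hb x i), ?_⟩
    rw [Fin.prod_univ_eq_prod_range (fun i => w i (digit b x i)) (φ n)]
    exact hφE n x hx
  refine (MeasureTheory.Measure.hausdorffMeasure_le_liminf_sum (s : ℝ) E _ hr t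
    (Eventually.of_forall hdiam) (Eventually.of_forall hcov)).trans ?_
  -- All product weights together sum to at most `1`, so at most `B_N ^ s` cylinders have weight at
  -- least `B_N ^ (-s)`.
  have hcard : ∀ n, ((S n).card : ℝ) * (baseProd b (φ n) : ℝ) ^ (-(s : ℝ)) ≤ 1 := by
    intro n
    calc ((S n).card : ℝ) * (baseProd b (φ n) : ℝ) ^ (-(s : ℝ))
        = ∑ v ∈ S n, (baseProd b (φ n) : ℝ) ^ (-(s : ℝ)) := by
          rw [Finset.sum_const, nsmul_eq_mul]
      _ ≤ ∑ v ∈ S n, ∏ i : Fin (φ n), w i (v i) :=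
          Finset.sum_le_sum fun v hv => (Finset.mem_filter.1 hv).2
      _ ≤ ∑ v ∈ Fintype.piFinset fun i : Fin (φ n) => range (b i), ∏ i : Fin (φ n), w i (v i) :=
          Finset.sum_le_sum_of_subset_of_nonneg (Finset.filter_subset _ _) fun v _ _ =>
            Finset.prod_nonneg fun i _ => hw0 _ _
      _ = ∏ i : Fin (φ n), ∑ j ∈ range (b i), w i j := (Finset.prod_univ_sum _ _).symm
      _ ≤ 1 := Finset.prod_le_one (fun i _ => Finset.sum_nonneg fun j _ => hw0 _ _)
          fun i _ => hw1 i
  have hle : ∀ n, ∑ v : S n, Metric.ediam (t n v) ^ (s : ℝ) ≤ 1 := by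
    intro n
    have hpos := baseProd_pos hb (φ n)
    calc ∑ v : S n, Metric.ediam (t n v) ^ (s : ℝ)
        ≤ ∑ v : S n, ENNReal.ofReal ((baseProd b (φ n) : ℝ) ^ (-(s : ℝ))) := by
          refine Finset.sum_le_sum fun v _ => ?_
          refine (ENNReal.rpow_le_rpow (hdiam n v) s.2).trans_eq ?_
          rw [ENNReal.ofReal_rpow_of_pos (by positivity), one_div, Real.inv_rpow hpos.le,
            Real.rpow_neg hpos.le]
          rfl
      _ = ENNReal.ofReal (((S n).card : ℝ) * (baseProd b (φ n) : ℝ) ^ (-(s : ℝ))) := by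
          rw [Finset.sum_const, Finset.card_univ, Fintype.card_coe, nsmul_eq_mul,
            ENNReal.ofReal_mul (by positivity), ENNReal.ofReal_natCast]
      _ ≤ 1 := ENNReal.ofReal_le_one.2 (hcard n)
  exact liminf_le_of_le (by isBoundedDefault) fun a ha => by
    obtain ⟨n, hn⟩ := ha.exists
    exact hn.trans (hle n)

end Upper

/-! ### Empirical pair counts and the upper bound for `J_A(α)` -/

section UpperLevelSet

variable {b : ℕ → ℕ} {d α : ℕ → ℝ}

/-- The number of positions below `N` with base `n` and digit `j`, for a digit sequence `e`. -/
def pairCount (b e : ℕ → ℕ) (N n j : ℕ) : ℕ :=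
  ((range N).filter fun i => b i = n ∧ e i = j).card

theorem sum_eq_sum_pairCount (b : ℕ → ℕ) {e : ℕ → ℕ} (he : ∀ i, e i < b i) (F : ℕ → ℕ → ℝ)
    {T : ℕ} (hF : ∀ n, T ≤ n → ∀ j < n, F n j = 0) (N : ℕ) :
    ∑ i ∈ range N, F (b i) (e i) =
      ∑ n ∈ range T, ∑ j ∈ range n, (pairCount b e N n j : ℝ) * F n j := by
  have h1 : ∀ i, F (b i) (e i) =
      ∑ n ∈ range T, ∑ j ∈ range n, if b i = n ∧ e i = j then F n j else 0 := by
    intro i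
    rcases lt_or_ge (b i) T with hT | hT
    · rw [Finset.sum_eq_single_of_mem (b i) (Finset.mem_range.2 hT),
        Finset.sum_eq_single_of_mem (e i) (Finset.mem_range.2 (he i)), if_pos ⟨rfl, rfl⟩]
      · intro j _ hj
        rw [if_neg fun h => hj h.2.symm]
      · intro n _ hn
        exact Finset.sum_eq_zero fun j _ => if_neg fun h => hn h.1.symm
    · rw [hF _ hT _ (he i)]
      refine (Finset.sum_eq_zero fun n hn => Finset.sum_eq_zero fun j _ => if_neg fun h => ?_).symm
      have := Finset.mem_range.1 hn
      omega
  simp_rw [h1]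
  rw [Finset.sum_comm]
  refine Finset.sum_congr rfl fun n _ => ?_
  rw [Finset.sum_comm]
  refine Finset.sum_congr rfl fun j _ => ?_
  rw [← Finset.sum_filter, Finset.sum_const, nsmul_eq_mul, pairCount]

theorem sum_pairCount_base {e : ℕ → ℕ} (he : ∀ i, e i < b i) (N n : ℕ) :
    ∑ j ∈ range n, pairCount b e N n j = baseCount b n N := by
  unfold pairCount baseCount
  rw [← Finset.card_biUnion]
  · congr 1
    ext i
    have := he i
    simp
    omega
  · intro k _ k' _ hkk
    rw [Function.onFun, Finset.disjoint_filter]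
    rintro i _ h1 h2
    exact hkk (h1.2.symm.trans h2.2)

theorem sum_pairCount_digit_le (b e : ℕ → ℕ) (N j : ℕ) (s : Finset ℕ) :
    ∑ n ∈ s, pairCount b e N n j ≤ ((range N).filter fun i => e i = j).card := by
  unfold pairCount
  rw [← Finset.card_biUnion]
  · refine Finset.card_le_card fun i hi => ?_
    simp at hi ⊢
    tauto
  · intro k _ k' _ hkk
    rw [Function.onFun, Finset.disjoint_filter]
    rintro i _ h1 h2
    exact hkk (h1.1.symm.trans h2.1)

/-- The counting version of `sum_range_add_sum_le`: positions with base at most `k`, and positions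
with larger base and digit below `k`, are disjoint and all have a digit below `k`. -/
theorem sum_pairCount_add_le {e : ℕ → ℕ} (he : ∀ i, e i < b i) (N k T : ℕ) :
    ∑ n ∈ Finset.Ico (k + 1) T, ∑ j ∈ range k, pairCount b e N n j +
      ∑ n ∈ range (k + 1), baseCount b n N ≤
    ∑ j ∈ range k, ((range N).filter fun i => e i = j).card := by
  have h1 : ∀ n, ∑ j ∈ range k, pairCount b e N n j =
      ((range N).filter fun i => b i = n ∧ e i < k).card := by
    intro n
    unfold pairCount
    rw [← Finset.card_biUnion]
    · congr 1
      ext i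
      simp
      tauto
    · intro k _ k' _ hkk
      rw [Function.onFun, Finset.disjoint_filter]
      rintro i _ h1 h2
      exact hkk (h1.2.symm.trans h2.2)
  have h2 : ∑ n ∈ Finset.Ico (k + 1) T, ∑ j ∈ range k, pairCount b e N n j =
      ((range N).filter fun i => b i ∈ Finset.Ico (k + 1) T ∧ e i < k).card := by
    simp_rw [h1]
    rw [← Finset.card_biUnion]
    · congr 1
      ext i
      simp
      tauto
    · intro k _ k' _ hkk
      rw [Function.onFun, Finset.disjoint_filter]
      rintro i _ h1 h2
      exact hkk (h1.1.symm.trans h2.1)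
  have h3 : ∑ n ∈ range (k + 1), baseCount b n N =
      ((range N).filter fun i => b i < k + 1).card := by
    unfold baseCount
    rw [← Finset.card_biUnion]
    · congr 1
      ext i
      simp
      tauto
    · intro k _ k' _ hkk
      rw [Function.onFun, Finset.disjoint_filter]
      rintro i _ h1 h2
      exact hkk (h1.symm.trans h2)
  have h4 : ∑ j ∈ range k, ((range N).filter fun i => e i = j).card =
      ((range N).filter fun i => e i < k).card := by
    rw [← Finset.card_biUnion]
    · congr 1
      ext i
      simp
      tauto
    · intro k _ k' _ hkk
      rw [Function.onFun, Finset.disjoint_filter]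
      rintro i _ h1 h2
      exact hkk (h1.symm.trans h2)
  rw [h2, h3, h4, ← Finset.card_union_of_disjoint]
  · refine Finset.card_le_card fun i hi => ?_
    have := he i
    simp at hi ⊢
    omega
  · rw [Finset.disjoint_filter]
    rintro i _ h5 h6
    simp at h5
    omega

/-- An upper bound for `∑_{i<N} logLoss (b i) (e i)`, the sum being over small bases. -/
noncomputable def countBound (b e : ℕ → ℕ) (d α : ℕ → ℝ) (T N : ℕ) : ℝ :=
  ∑ j ∈ range T, -Real.log (α j) * ((((range N).filter fun i => e i = j).card : ℝ) / N) +
    ∑ n ∈ range T, Real.log (massA d α n) * ((baseCount b n N : ℝ) / N) +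
    ∑ k ∈ range T, -Real.log (factor d α k) *
      (∑ j ∈ range k, (((range N).filter fun i => e i = j).card : ℝ) / N -
        ∑ n ∈ range (k + 1), (baseCount b n N : ℝ) / N)

theorem sum_pairCount_mul_logLoss_le (hα : IsStochastic α) (hd0 : ∀ n, 0 ≤ d n)
    (hd2 : ∀ n < 2, d n = 0) (hne : (admissible d α).Nonempty) {e : ℕ → ℕ}
    (he : ∀ i, e i < b i) (T N : ℕ) :
    ∑ n ∈ range T, ∑ j ∈ range n, ((pairCount b e N n j : ℝ) / N) * logLoss d α n j ≤
      countBound b e d α T N := by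
  rw [sum_mul_logLoss (fun n j => (pairCount b e N n j : ℝ) / N), countBound]
  refine add_le_add (add_le_add ?_ (le_of_eq ?_)) ?_
  · refine Finset.sum_le_sum fun j _ =>
      mul_le_mul_of_nonneg_left ?_ (neg_log_nonneg_of_isStochastic hα j)
    rw [← Finset.sum_div]
    gcongr
    exact_mod_cast sum_pairCount_digit_le b e N j _
  · refine Finset.sum_congr rfl fun n _ => ?_
    rw [← Finset.sum_div, ← Nat.cast_sum, sum_pairCount_base he]
  · refine Finset.sum_le_sum fun k _ =>
      mul_le_mul_of_nonneg_left ?_ (neg_log_factor_nonneg hd0 hd2 hne k)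
    simp_rw [← Finset.sum_div]
    rw [← sub_div]
    gcongr
    have h : (∑ n ∈ Finset.Ico (k + 1) T, ∑ j ∈ range k, (pairCount b e N n j : ℝ)) +
        ∑ n ∈ range (k + 1), (baseCount b n N : ℝ) ≤
        ∑ j ∈ range k, (((range N).filter fun i => e i = j).card : ℝ) := by
      exact_mod_cast sum_pairCount_add_le he N k T
    linarith

variable (hb : ∀ i, 2 ≤ b i) (hd : IsBaseFrequency b d) (hα : IsStochastic α)
  (hne : (admissible d α).Nonempty) {e : ℕ → ℕ} (he : ∀ i, e i < b i)
  (hfreq : ∀ j, Tendsto (fun n : ℕ => (((range n).filter fun i => e i = j).card : ℝ) / n) atTop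
    (𝓝 (α j)))

include hb hd hne hfreq in
theorem tendsto_countDifference (k : ℕ) :
    Tendsto (fun N : ℕ => ∑ j ∈ range k, (((range N).filter fun i => e i = j).card : ℝ) / N -
        ∑ n ∈ range (k + 1), (baseCount b n N : ℝ) / N) atTop (𝓝 (massA d α k - d k)) := by
  have hd0 := baseFrequency_nonneg hd
  have hd2 : ∀ n < 2, d n = 0 := fun n hn => baseFrequency_eq_zero hb hd hn
  have h := (tendsto_finsetSum (range k) fun j _ => hfreq j).sub
    (tendsto_finsetSum (range (k + 1)) fun n _ => hd n)
  rwa [Finset.sum_range_succ d, ← sub_sub, ← massA_eq hd0 hd2 hne] at h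

include hb hd hne hfreq in
-- `countBound` involves digit counts and base counts but no joint counts; therefore it converges at
-- every point of `J_A(α)`.
theorem tendsto_countBound (T : ℕ) :
    Tendsto (countBound b e d α T) atTop (𝓝 (lossBound d α T)) :=
  ((tendsto_finsetSum _ fun j _ => (hfreq j).const_mul _).add
    (tendsto_finsetSum _ fun n _ => (hd n).const_mul _)).add
    (tendsto_finsetSum _ fun k _ => (tendsto_countDifference hb hd hne hfreq k).const_mul _)

include hb hd hne he hfreq in
/-- Pairs which do not occur under `P^α` have frequency zero. -/
theorem tendsto_pairCount_zero {n j : ℕ} (hj : j < n)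
    (h : optMatrix d α n j = 0 ∨ d n = 0) :
    Tendsto (fun N => (pairCount b e N n j : ℝ) / N) atTop (𝓝 0) := by
  have hd0 := baseFrequency_nonneg hd
  have hd2 : ∀ n < 2, d n = 0 := fun n hn => baseFrequency_eq_zero hb hd hn
  by_cases hdn : d n = 0
  · refine squeeze_zero (fun N => by positivity) (fun N => ?_) (hdn ▸ hd n)
    gcongr
    exact Finset.card_le_card fun i hi => by
      simp at hi ⊢
      tauto
  have hgood : jMin α < n ∧ massA d α n ≠ 0 :=
    by_contra fun hb => hdn (baseFrequency_eq_zero_of_not hd0 hd2 hne hb)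
  have h0 := h.resolve_right hdn
  rw [optMatrix_eq hgood hj, div_eq_zero_iff, or_iff_left hgood.2, remaining, mul_eq_zero,
    Finset.prod_eq_zero_iff] at h0
  rcases h0 with h0 | ⟨k, hk, h0⟩
  · refine squeeze_zero (fun N => by positivity) (fun N => ?_) (h0 ▸ hfreq j)
    gcongr
    exact Finset.card_le_card fun i hi => by
      simp at hi ⊢
      tauto
  -- If the factor at `k` vanishes, the limit `A_k - d k` is zero. The difference bounds the share
  -- of positions with digit below `k` and base in `(k, n]`, which include the pair `(n, j)`.
  · have h1 := tendsto_countDifference hb hd hne hfreq k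
    rw [← massA_mul_factor hd0 hd2 hne, h0, mul_zero] at h1
    refine squeeze_zero (fun N => by positivity) (fun N => ?_) h1
    simp_rw [← Finset.sum_div]
    rw [← sub_div]
    gcongr
    rw [Finset.mem_Ico] at hk
    have h2 := sum_pairCount_add_le he N k (n + 1)
    have h3 : pairCount b e N n j ≤
        ∑ n ∈ Finset.Ico (k + 1) (n + 1), ∑ j ∈ range k, pairCount b e N n j :=
      (Finset.single_le_sum (f := fun j => pairCount b e N n j) (fun _ _ => Nat.zero_le _)
        (Finset.mem_range.2 (by omega : j < k))).trans
      (Finset.single_le_sum (f := fun n => ∑ j ∈ range k, pairCount b e N n j)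
        (fun _ _ => Nat.zero_le _) (by simp; omega))
    have h4 : (pairCount b e N n j : ℝ) + ∑ n ∈ range (k + 1), (baseCount b n N : ℝ) ≤
        ∑ j ∈ range k, (((range N).filter fun i => e i = j).card : ℝ) := by
      exact_mod_cast (Nat.add_le_add_right h3 _).trans h2
    linarith

/-- Weights of digits: `P^α` mixed with the uniform distribution for small bases, uniform
for large bases. -/
noncomputable def mixedWeight (d α : ℕ → ℝ) (T : ℕ) (δ : ℝ) (n j : ℕ) : ℝ :=
  if n < T then (1 - δ) * optMatrix d α n j + δ * (n : ℝ)⁻¹ else (n : ℝ)⁻¹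

theorem sum_mixedWeight {T : ℕ} {δ : ℝ} {n : ℕ} (hn : 2 ≤ n)
    (hS : optMatrix d α ∈ stochMatrices) :
    ∑ j ∈ range n, mixedWeight d α T δ n j = 1 := by
  have hn0 : (n : ℝ) ≠ 0 := by
    have : n ≠ 0 := by omega
    exact_mod_cast this
  unfold mixedWeight
  split_ifs with h
  · rw [Finset.sum_add_distrib, ← Finset.mul_sum, (hS n hn).2.2, Finset.sum_const,
      Finset.card_range, nsmul_eq_mul]
    field_simp
    ring
  · rw [Finset.sum_const, Finset.card_range, nsmul_eq_mul, mul_inv_cancel₀ hn0]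

theorem mixedWeight_pos {T : ℕ} {δ : ℝ} (hδ0 : 0 < δ) (hδ1 : δ < 1) {n : ℕ} (hn : 2 ≤ n)
    (hS : optMatrix d α ∈ stochMatrices) (j : ℕ) : 0 < mixedWeight d α T δ n j := by
  have hn0 : (0 : ℝ) < n := by
    have : 0 < n := by omega
    exact_mod_cast this
  unfold mixedWeight
  split_ifs with h
  · have := mul_nonneg (sub_pos.2 hδ1).le ((hS n hn).1 j)
    positivity
  · positivity

include hb hd hα hne in
theorem exists_log_mixedWeight_ge {T : ℕ} {δ : ℝ} (hδ0 : 0 < δ) (hδ1 : δ < 1) :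
    ∃ C : ℝ, ∀ n < T, 2 ≤ n → ∀ j < n, Real.log (1 - δ) - logLoss d α n j -
      C * (if optMatrix d α n j = 0 ∨ d n = 0 then 1 else 0) ≤
        Real.log (mixedWeight d α T δ n j) := by
  have hd0 := baseFrequency_nonneg hd
  have hd2 : ∀ n < 2, d n = 0 := fun n hn => baseFrequency_eq_zero hb hd hn
  have hS := optMatrix_mem_stochMatrices hα hd0 hd2 hne
  set G : ℕ → ℕ → ℝ := fun n j => |Real.log (1 - δ) - logLoss d α n j -
    Real.log (mixedWeight d α T δ n j)| with hG
  -- Only finitely many pairs have base below `T`, so the sum of all discrepancies dominates each.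
  -- The penalty is charged only to pairs of asymptotic frequency zero.
  refine ⟨∑ n ∈ range T, ∑ j ∈ range n, G n j, fun n hn hn2 j hj => ?_⟩
  split_ifs with h
  · have h1 : G n j ≤ ∑ n ∈ range T, ∑ j ∈ range n, G n j :=
      (Finset.single_le_sum (f := fun j => G n j) (fun _ _ => abs_nonneg _)
        (Finset.mem_range.2 hj)).trans
      (Finset.single_le_sum (f := fun n => ∑ j ∈ range n, G n j)
        (fun _ _ => Finset.sum_nonneg fun _ _ => abs_nonneg _) (Finset.mem_range.2 hn))
    have h2 := le_abs_self (Real.log (1 - δ) - logLoss d α n j -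
      Real.log (mixedWeight d α T δ n j))
    simp only [hG] at h1
    linarith
  · push Not at h
    rw [← neg_log_optMatrix (by_contra fun hb =>
      h.2 (baseFrequency_eq_zero_of_not hd0 hd2 hne hb)) hj h.1, mul_zero, sub_zero, sub_neg_eq_add,
      ← Real.log_mul (by linarith) h.1]
    have h3 : 0 < optMatrix d α n j := lt_of_le_of_ne ((hS n hn2).1 j) (Ne.symm h.1)
    have h4 : 0 < 1 - δ := by linarith
    refine Real.log_le_log (by positivity) ?_
    rw [mixedWeight, if_pos hn]
    have : 0 ≤ δ * (n : ℝ)⁻¹ := by positivity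
    linarith

include hb hd hα hne he hfreq in
-- Bases at least `T` contribute zero, their weights being uniform. For smaller bases the weight is
-- at least `(1 - δ) p^α`, apart from pairs of frequency zero, and the total loss is controlled by
-- `countBound`.
theorem eventually_sum_log_mixedWeight_ge {T : ℕ} {δ : ℝ} (hδ0 : 0 < δ) (hδ1 : δ < 1) {ε : ℝ}
    (hε : 0 < ε) : ∀ᶠ N : ℕ in atTop,
      (∑ n ∈ range T, d n * Real.log n + Real.log (1 - δ) - lossBound d α T - ε) * N ≤
        ∑ i ∈ range N, (Real.log (b i) + Real.log (mixedWeight d α T δ (b i) (e i))) := by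
  have hd0 := baseFrequency_nonneg hd
  have hd2 : ∀ n < 2, d n = 0 := fun n hn => baseFrequency_eq_zero hb hd hn
  obtain ⟨C, hC⟩ := exists_log_mixedWeight_ge hb hd hα hne (T := T) hδ0 hδ1
  set Z : ℕ → ℕ → ℝ := fun n j => if optMatrix d α n j = 0 ∨ d n = 0 then 1 else 0 with hZ
  have hZlim : Tendsto (fun N : ℕ => ∑ n ∈ range T, ∑ j ∈ range n,
      ((pairCount b e N n j : ℝ) / N) * (C * Z n j)) atTop (𝓝 0) := by
    rw [show (0 : ℝ) = ∑ n ∈ range T, ∑ j ∈ range n, 0 by simp]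
    refine tendsto_finsetSum _ fun n _ => tendsto_finsetSum _ fun j hj => ?_
    simp only [hZ]
    split_ifs with h
    · simpa using (tendsto_pairCount_zero hb hd hne he hfreq (Finset.mem_range.1 hj) h).mul_const
        (C * 1)
    · simp
  have hlim := (((tendsto_finsetSum (range T) fun n _ => (hd n).mul_const (Real.log n)).add_const
    (Real.log (1 - δ))).sub (tendsto_countBound hb hd hne hfreq T)).sub hZlim
  rw [sub_zero] at hlim
  have hlt : ∑ n ∈ range T, d n * Real.log n + Real.log (1 - δ) - lossBound d α T - ε <
      ∑ n ∈ range T, d n * Real.log n + Real.log (1 - δ) - lossBound d α T := by linarith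
  filter_upwards [hlim.eventually (lt_mem_nhds hlt), eventually_gt_atTop 0] with N hN hN0
  have hNpos : (0 : ℝ) < N := by exact_mod_cast hN0
  rw [sum_eq_sum_pairCount b he (fun n j => Real.log n + Real.log (mixedWeight d α T δ n j))
    (T := T) ?_ N]
  swap
  · intro n hn j _
    rw [mixedWeight, if_neg (by omega), Real.log_inv]
    ring
  rw [← le_div_iff₀ hNpos]
  refine hN.le.trans ?_
  rw [Finset.sum_div]
  simp_rw [Finset.sum_div]
  have hpair : ∀ n ∈ range T, ∀ j ∈ range n, ((pairCount b e N n j : ℝ) / N) * (Real.log n +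
      Real.log (1 - δ) - logLoss d α n j - C * Z n j) ≤
      (pairCount b e N n j : ℝ) * (Real.log n + Real.log (mixedWeight d α T δ n j)) / N := by
    intro n hn j hj
    rw [mul_div_right_comm]
    rcases lt_or_ge n 2 with h2 | h2
    · have h3 : pairCount b e N n j = 0 := by
        unfold pairCount
        rw [Finset.card_eq_zero, Finset.filter_eq_empty_iff]
        rintro i _ ⟨h3, _⟩
        have := hb i
        omega
      simp [h3]
    · gcongr
      have := hC n (Finset.mem_range.1 hn) h2 j (Finset.mem_range.1 hj)
      simp only [hZ]
      linarith
  refine le_trans ?_ (Finset.sum_le_sum fun n hn => Finset.sum_le_sum fun j hj => hpair n hn j hj)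
  have hsplit : ∑ n ∈ range T, ∑ j ∈ range n, ((pairCount b e N n j : ℝ) / N) * (Real.log n +
      Real.log (1 - δ) - logLoss d α n j - C * Z n j) =
      ∑ n ∈ range T, (∑ j ∈ range n, (pairCount b e N n j : ℝ) / N) * Real.log n +
      (∑ n ∈ range T, ∑ j ∈ range n, (pairCount b e N n j : ℝ) / N) * Real.log (1 - δ) -
      ∑ n ∈ range T, ∑ j ∈ range n, ((pairCount b e N n j : ℝ) / N) * logLoss d α n j -
      ∑ n ∈ range T, ∑ j ∈ range n, ((pairCount b e N n j : ℝ) / N) * (C * Z n j) := by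
    rw [Finset.sum_mul, ← Finset.sum_add_distrib, ← Finset.sum_sub_distrib,
      ← Finset.sum_sub_distrib]
    refine Finset.sum_congr rfl fun n _ => ?_
    rw [Finset.sum_mul, Finset.sum_mul, ← Finset.sum_add_distrib, ← Finset.sum_sub_distrib,
      ← Finset.sum_sub_distrib]
    exact Finset.sum_congr rfl fun j _ => by ring
  rw [hsplit]
  have hbase : ∀ n, ∑ j ∈ range n, (pairCount b e N n j : ℝ) / N = (baseCount b n N : ℝ) / N := by
    intro n
    rw [← Finset.sum_div, ← Nat.cast_sum, sum_pairCount_base he]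
  simp_rw [hbase]
  have htot : (∑ n ∈ range T, (baseCount b n N : ℝ) / N) ≤ 1 := by
    rw [← Finset.sum_div, div_le_one hNpos, ← Nat.cast_sum, Nat.cast_le]
    unfold baseCount
    rw [← Finset.card_biUnion]
    · refine (Finset.card_le_card (t := range N) fun i hi => ?_).trans_eq (Finset.card_range N)
      simp at hi ⊢
      tauto
    · intro k _ k' _ hkk
      rw [Function.onFun, Finset.disjoint_filter]
      rintro i _ h1 h2
      exact hkk (h1.symm.trans h2)
  have hlog : Real.log (1 - δ) ≤ 0 := Real.log_nonpos (by linarith) (by linarith)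
  have h5 := mul_le_mul_of_nonpos_right htot hlog
  have h6 := sum_pairCount_mul_logLoss_le hα hd0 hd2 hne he T N
  linarith

include hb hd hα hne in
theorem dimH_levelSet_le (hd1 : HasSum d 1) (hs : Summable fun n : ℕ => d n * Real.log n)
    {κ : ℝ} (hκ : κ < ∑' n : ℕ, d n * Real.log n - ∑' n, d n * rowEntropy (optMatrix d α) n)
    {s : NNReal} (hfr : ∃ᶠ N : ℕ in atTop, (1 - s) * Real.log (baseProd b N) ≤ κ * N) :
    dimH (levelSet b α) ≤ s := by
  have hd0 := baseFrequency_nonneg hd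
  have hd2 : ∀ n < 2, d n = 0 := fun n hn => baseFrequency_eq_zero hb hd hn
  have hS := optMatrix_mem_stochMatrices hα hd0 hd2 hne
  set H := ∑' n : ℕ, d n * Real.log n with hH
  set E := ∑' n, d n * rowEntropy (optMatrix d α) n with hE
  -- One `ε` each for the bound on `lossBound`, the tail of `H`, the mixing cost `log (1 - δ) = -ε`,
  -- and the convergence in `N`.
  obtain ⟨ε, hε, hκε⟩ : ∃ ε > 0, κ + 4 * ε = H - E := ⟨(H - E - κ) / 4, by linarith, by ring⟩
  obtain ⟨T, hT1, hT2⟩ := ((eventually_lossBound_le hα hd0 hd2 hd1 hne hs hε).and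
    (hs.hasSum.tendsto_sum_nat.eventually (lt_mem_nhds (sub_lt_self H hε)))).exists
  set δ : ℝ := 1 - Real.exp (-ε) with hδ
  have hδ0 : 0 < δ := sub_pos.2 (by simpa using hε)
  have hδ1 : δ < 1 := sub_lt_self _ (Real.exp_pos _)
  have hlogδ : Real.log (1 - δ) = -ε := by rw [hδ, sub_sub_cancel, Real.log_exp]
  -- The estimate starts at an `N₀` depending on the point; countable stability of dimension allows
  -- fixing `N₀`.
  set E' : ℕ → Set ℝ := fun N₀ => {x | x ∈ Set.Icc (0 : ℝ) 1 ∧ ∀ N ≥ N₀, κ * N ≤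
    ∑ i ∈ range N, (Real.log (b i) + Real.log (mixedWeight d α T δ (b i) (digit b x i)))} with hE'
  have hcov : levelSet b α ⊆ ⋃ N₀, E' N₀ := by
    intro x hx
    obtain ⟨N₀, hN₀⟩ := eventually_atTop.1 (eventually_sum_log_mixedWeight_ge hb hd hα hne
      (digit_lt hb x) hx.2 (T := T) hδ0 hδ1 hε)
    refine Set.mem_iUnion.2 ⟨N₀, hx.1, fun N hN => le_trans ?_ (hN₀ N hN)⟩
    rw [hlogδ]
    gcongr
    linarith
  refine (dimH_mono hcov).trans ?_
  rw [dimH_iUnion]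
  refine iSup_le fun N₀ => ?_
  refine dimH_le_of_weight hb (w := fun i j => mixedWeight d α T δ (b i) j) (fun x hx => hx.1)
    (fun i j => (mixedWeight_pos hδ0 hδ1 (hb i) hS j).le) (fun i => (sum_mixedWeight (hb i) hS).le)
    ?_
  refine (hfr.and_eventually (eventually_ge_atTop N₀)).mono ?_
  rintro N ⟨hN1, hN2⟩ x hx
  have h1 := hx.2 N hN2
  have hpos : 0 < ∏ i ∈ range N, mixedWeight d α T δ (b i) (digit b x i) :=
    Finset.prod_pos fun i _ => mixedWeight_pos hδ0 hδ1 (hb i) hS _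
  rw [← Real.log_le_log_iff (Real.rpow_pos_of_pos (baseProd_pos hb N) _) hpos,
    Real.log_rpow (baseProd_pos hb N),
    Real.log_prod fun i _ => (mixedWeight_pos hδ0 hδ1 (hb i) hS _).ne']
  rw [Finset.sum_add_distrib, ← log_baseProd hb] at h1
  linarith

end UpperLevelSet

open MeasureTheory

/-! ### A mass distribution principle for Cantor series -/

section Mass

variable {b : ℕ → ℕ}

/-- The index of the cylinder of order `N` given by the digits `e`. -/
def cylinderIndex (b e : ℕ → ℕ) : ℕ → ℕ
  | 0 => 0
  | N + 1 => cylinderIndex b e N * b N + e N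

theorem sum_digits_eq_cylinderIndex_div (hb : ∀ i, 2 ≤ b i) (e : ℕ → ℕ) (N : ℕ) :
    ∑ i ∈ range N, (e i : ℝ) / baseProd b (i + 1) = cylinderIndex b e N / baseProd b N := by
  induction N with
  | zero => simp [cylinderIndex]
  | succ N ih =>
    rw [Finset.sum_range_succ, ih, cylinderIndex, baseProd_succ]
    have h1 := (baseProd_pos hb N).ne'
    have h2 : (b N : ℝ) ≠ 0 := by
      have := hb N
      have : b N ≠ 0 := by omega
      exact_mod_cast this
    push_cast
    field_simp

theorem eq_of_cylinderIndex_eq {e e' : ℕ → ℕ} (he : ∀ i, e i < b i) (he' : ∀ i, e' i < b i)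
    {N : ℕ} (h : cylinderIndex b e N = cylinderIndex b e' N) : ∀ i < N, e i = e' i := by
  induction N with
  | zero => intro i hi; omega
  | succ N ih =>
    rw [cylinderIndex, cylinderIndex] at h
    have h1 : e N = e' N := by
      have := congrArg (· % b N) h
      simpa [Nat.mul_add_mod_of_lt (he N), Nat.mul_add_mod_of_lt (he' N),
        Nat.mod_eq_of_lt (he N), Nat.mod_eq_of_lt (he' N)] using this
    have hpos : 0 < b N := (Nat.zero_le _).trans_lt (he N)
    have h2 : cylinderIndex b e N = cylinderIndex b e' N := by
      rw [h1] at h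
      exact Nat.eq_of_mul_eq_mul_right hpos (Nat.add_right_cancel h)
    intro i hi
    rcases Nat.lt_succ_iff_lt_or_eq.1 hi with h3 | rfl
    · exact ih h2 i h3
    · exact h1

/-- Strictness excludes tails of maximal digits, so that `digit` recovers `e` from its value. -/
theorem cantorValue_lt (hb : ∀ i, 2 ≤ b i) {e : ℕ → ℕ} (he : ∀ i, e i < b i)
    (hfr : ∃ᶠ i in atTop, e i + 1 < b i) (N : ℕ) : cantorValue b e <
      ∑ i ∈ range N, (e i : ℝ) / baseProd b (i + 1) + 1 / baseProd b N := by
  obtain ⟨n, hn1, hn2⟩ := (hfr.and_eventually (eventually_ge_atTop N)).exists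
  refine (cantorValue_le hb he (n + 1)).trans_lt ?_
  have h1 := sum_Ico_digits_le hb he hn2
  rw [Finset.sum_range_succ, ← Finset.sum_range_add_sum_Ico _ hn2]
  have h2 : (e n : ℝ) / baseProd b (n + 1) + 1 / baseProd b (n + 1) < 1 / baseProd b n := by
    rw [← add_div, baseProd_succ, Nat.cast_mul]
    have h3 := baseProd_pos hb n
    have h4 : (0 : ℝ) < b n := by
      have := hb n
      have : 0 < b n := by omega
      exact_mod_cast this
    rw [div_lt_div_iff₀ (by positivity) h3]
    have h5 : (e n : ℝ) + 1 < b n := by exact_mod_cast hn1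
    nlinarith
  linarith

theorem cantorValue_mem_Ico (hb : ∀ i, 2 ≤ b i) {e : ℕ → ℕ} (he : ∀ i, e i < b i)
    (hfr : ∃ᶠ i in atTop, e i + 1 < b i) : cantorValue b e ∈ Set.Ico (0 : ℝ) 1 := by
  constructor
  · simpa using sum_range_le_cantorValue hb he 0
  · simpa [baseProd] using cantorValue_lt hb he hfr 0

theorem digit_cantorValue (hb : ∀ i, 2 ≤ b i) {e : ℕ → ℕ} (he : ∀ i, e i < b i)
    (hfr : ∃ᶠ i in atTop, e i + 1 < b i) : digit b (cantorValue b e) = e := by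
  funext i
  have hfloor : ⌊cantorValue b e * (∏ k ∈ range (i + 1), b k : ℕ)⌋₊ =
      cylinderIndex b e (i + 1) := by
    have h1 := sum_range_le_cantorValue hb he (i + 1)
    have h2 := cantorValue_lt hb he hfr (i + 1)
    have h3 := baseProd_pos hb (i + 1)
    rw [sum_digits_eq_cylinderIndex_div hb] at h1 h2
    rw [← add_div, lt_div_iff₀ h3] at h2
    rw [div_le_iff₀ h3] at h1
    rw [← baseProd, Nat.floor_eq_iff ((Nat.cast_nonneg _).trans h1)]
    exact ⟨h1, h2⟩
  rw [digit, if_neg (cantorValue_mem_Ico hb he hfr).2.ne, hfloor, cylinderIndex,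
    Nat.mul_add_mod_of_lt (he i)]

theorem countable_setOf_eventually_eq (c : ℕ → ℕ) :
    {e : ℕ → ℕ | ∀ᶠ i in atTop, e i = c i}.Countable := by
  have : {e : ℕ → ℕ | ∀ᶠ i in atTop, e i = c i} ⊆
      ⋃ K : ℕ, Set.range fun v : Fin K → ℕ => fun i => if h : i < K then v ⟨i, h⟩ else c i := by
    intro e he
    obtain ⟨K, hK⟩ := eventually_atTop.1 he
    refine Set.mem_iUnion.2 ⟨K, fun i => e i, ?_⟩
    funext i
    simp only []
    split_ifs with h
    · rfl
    · exact (hK i (not_lt.1 h)).symm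
  exact (Set.countable_iUnion fun K => Set.countable_range _).mono this

/-- Capping the digits makes the series converge for every sequence, so the map is measurable on the
whole product space. -/
theorem measurable_cantorValue_min (hb : ∀ i, 2 ≤ b i) :
    Measurable fun e : ℕ → ℕ => cantorValue b fun i => min (e i) (b i - 1) := by
  refine measurable_of_tendsto_metrizable
    (f := fun N (e : ℕ → ℕ) =>
      ∑ i ∈ range N, ((min (e i) (b i - 1) : ℕ) : ℝ) / baseProd b (i + 1)) (fun N => ?_) ?_
  · refine Finset.measurable_sum _ fun i _ => ?_
    exact (measurable_from_nat (f := fun k : ℕ =>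
      ((min k (b i - 1) : ℕ) : ℝ) / baseProd b (i + 1))).comp (measurable_pi_apply i)
  · rw [tendsto_pi_nhds]
    intro e
    refine (summable_digits hb fun i => ?_).hasSum.tendsto_sum_nat
    have := hb i
    omega

theorem card_Icc_ceil_floor_le {u v : ℝ} (h : u ≤ v + 1) :
    ((Finset.Icc ⌈u⌉ ⌊v⌋).card : ℝ) ≤ v - u + 1 := by
  rw [Int.card_Icc]
  have h1 := Int.floor_le v
  have h2 := Int.le_ceil u
  rcases le_total 0 (⌊v⌋ + 1 - ⌈u⌉) with h3 | h3
  · have h4 : (((⌊v⌋ + 1 - ⌈u⌉).toNat : ℤ) : ℝ) = ((⌊v⌋ + 1 - ⌈u⌉ : ℤ) : ℝ) := by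
      rw [Int.toNat_of_nonneg h3]
    rw [Int.cast_natCast] at h4
    rw [h4]
    push_cast
    linarith
  · rw [Int.toNat_of_nonpos h3, Nat.cast_zero]
    linarith

variable (ν : ℕ → Measure ℕ) [∀ i, IsProbabilityMeasure (ν i)]

theorem infinitePi_cylinder_le {G : Set (ℕ → ℕ)} (hGe : ∀ e ∈ G, ∀ i, e i < b i) {N : ℕ}
    {c : ENNReal} (hcyl : ∀ e ∈ G, ∏ i ∈ range N, ν i {e i} ≤ c) (a : ℤ) :
    Measure.infinitePi ν (G ∩ {e | (cylinderIndex b e N : ℤ) = a}) ≤ c := by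
  rcases (G ∩ {e | (cylinderIndex b e N : ℤ) = a}).eq_empty_or_nonempty with h | ⟨e, he, hea⟩
  · rw [h]
    simp
  · refine le_trans ?_ (hcyl e he)
    rw [← Measure.infinitePi_pi ν (s := range N) (t := fun i => {e i})
      fun i _ => measurableSet_singleton _]
    refine measure_mono ?_
    rintro e' ⟨he', hea'⟩ i hi
    have h1 : (cylinderIndex b e' N : ℤ) = cylinderIndex b e N := hea'.trans hea.symm
    exact eq_of_cylinderIndex_eq (hGe e' he') (hGe e he) (by exact_mod_cast h1) i
      (Finset.mem_range.1 hi)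

/-- For `1 / B_{N+1} < r ≤ 1 / B_N` the ball meets at most `4 r B_{N+1}` cylinders of order `N + 1`,
each of measure at most `B_N ^ (-s) / b_N`; the product is `4 r B_N ^ (1 - s) ≤ 4 r ^ s`. The
division by `b_N` in the hypothesis handles radii between consecutive scales when the bases are
unbounded. -/
theorem infinitePi_closedBall_le (hb : ∀ i, 2 ≤ b i) {G : Set (ℕ → ℕ)}
    (hGe : ∀ e ∈ G, ∀ i, e i < b i) {s : ℝ} (hs1 : s ≤ 1) {N₀ : ℕ}
    (hcyl : ∀ e ∈ G, ∀ N ≥ N₀, ∏ i ∈ range (N + 1), ν i {e i} ≤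
      ENNReal.ofReal ((baseProd b N : ℝ) ^ (-s) / b N)) (x : ℝ) {r : ℝ} (hr : 0 < r)
    (hr1 : r ≤ 1 / baseProd b N₀) :
    Measure.infinitePi ν (G ∩ {e | cantorValue b e ∈ Metric.closedBall x r}) ≤
      ENNReal.ofReal (4 * r ^ s) := by
  obtain ⟨N, hN, hN1, hN2⟩ : ∃ N ≥ N₀, r ≤ 1 / baseProd b N ∧ 1 / baseProd b (N + 1) < r := by
    have hex : ∃ k, 1 / (baseProd b (N₀ + k) : ℝ) < r := by
      obtain ⟨n, hn1, hn2⟩ := (((tendsto_one_div_baseProd hb).eventually (gt_mem_nhds hr)).and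
        (eventually_ge_atTop N₀)).exists
      exact ⟨n - N₀, by rwa [Nat.add_sub_cancel' hn2]⟩
    classical
    have h1 := Nat.find_spec hex
    rcases hk : Nat.find hex with _ | k
    · rw [hk, add_zero] at h1
      linarith
    · rw [hk] at h1
      exact ⟨N₀ + k, by omega, not_lt.1 (Nat.find_min hex (by omega)), h1⟩
  set q : ℝ := (baseProd b (N + 1) : ℝ) with hq
  have hqpos : 0 < q := baseProd_pos hb (N + 1)
  have hrq : 1 < r * q := by rwa [div_lt_iff₀ hqpos] at hN2
  set I : Finset ℤ := Finset.Icc ⌈(x - r) * q - 1⌉ ⌊(x + r) * q⌋ with hI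
  have hsub : G ∩ {e | cantorValue b e ∈ Metric.closedBall x r} ⊆
      ⋃ a ∈ I, G ∩ {e | (cylinderIndex b e (N + 1) : ℤ) = a} := by
    rintro e ⟨he, hx⟩
    refine Set.mem_biUnion (x := (cylinderIndex b e (N + 1) : ℤ)) ?_ ⟨he, rfl⟩
    have h1 := sum_range_le_cantorValue hb (hGe e he) (N + 1)
    have h2 := cantorValue_le hb (hGe e he) (N + 1)
    rw [sum_digits_eq_cylinderIndex_div hb] at h1 h2
    rw [← add_div, le_div_iff₀ hqpos] at h2
    rw [div_le_iff₀ hqpos] at h1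
    have h3 := Metric.mem_closedBall.1 hx
    rw [Real.dist_eq, abs_le] at h3
    have h4 : (x - r) * q ≤ cantorValue b e * q := by
      gcongr
      linarith
    have h5 : cantorValue b e * q ≤ (x + r) * q := by
      gcongr
      linarith
    rw [Finset.mem_coe, hI, Finset.mem_Icc, Int.ceil_le, Int.le_floor]
    push_cast
    constructor <;> linarith
  -- The count is at most `2 r q + 2`, and `r q > 1`.
  have hcard : (I.card : ℝ) ≤ 4 * (r * q) := by
    refine (card_Icc_ceil_floor_le ?_).trans ?_ <;> nlinarith
  calc Measure.infinitePi ν (G ∩ {e | cantorValue b e ∈ Metric.closedBall x r})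
      ≤ ∑ a ∈ I, Measure.infinitePi ν (G ∩ {e | (cylinderIndex b e (N + 1) : ℤ) = a}) :=
        (measure_mono hsub).trans (measure_biUnion_finset_le _ _)
    _ ≤ ∑ a ∈ I, ENNReal.ofReal ((baseProd b N : ℝ) ^ (-s) / b N) :=
        Finset.sum_le_sum fun a _ => infinitePi_cylinder_le ν hGe (fun e he => hcyl e he N hN) a
    _ = ENNReal.ofReal (I.card * ((baseProd b N : ℝ) ^ (-s) / b N)) := by
        rw [Finset.sum_const, nsmul_eq_mul, ENNReal.ofReal_mul (by positivity),
          ENNReal.ofReal_natCast]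
    _ ≤ ENNReal.ofReal (4 * r ^ s) := by
        refine ENNReal.ofReal_le_ofReal ?_
        have hp := baseProd_pos hb N
        have hbN : (0 : ℝ) < b N := by
          have := hb N
          have : 0 < b N := by omega
          exact_mod_cast this
        calc (I.card : ℝ) * ((baseProd b N : ℝ) ^ (-s) / b N)
            ≤ 4 * (r * q) * ((baseProd b N : ℝ) ^ (-s) / b N) := by gcongr
          _ = 4 * (r * (baseProd b N : ℝ) ^ (1 - s)) := by
              rw [hq, baseProd_succ, sub_eq_add_neg, Real.rpow_add hp, Real.rpow_one]
              push_cast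
              field_simp
          _ ≤ 4 * (r * (1 / r) ^ (1 - s)) := by
              gcongr
              rwa [le_div_iff₀ hr, mul_comm, ← le_div_iff₀ hp]
          _ = 4 * r ^ s := by
              rw [one_div, Real.inv_rpow hr.le, ← Real.rpow_neg hr.le, neg_sub,
                Real.rpow_sub_one hr.ne']
              field_simp

/-- The mass distribution principle for the image measure. The ball estimate also excludes atoms in
`G`, so the countably many sequences with a maximal tail, where digits and value do not correspond,
can be discarded. -/
theorem le_dimH_of_cylinder_le (hb : ∀ i, 2 ≤ b i) {G : Set (ℕ → ℕ)} (hG : MeasurableSet G)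
    (hG0 : Measure.infinitePi ν G ≠ 0) (hGe : ∀ e ∈ G, ∀ i, e i < b i) {s : NNReal}
    (hs0 : 0 < s) (hs1 : s ≤ 1) {N₀ : ℕ}
    (hcyl : ∀ e ∈ G, ∀ N ≥ N₀, ∏ i ∈ range (N + 1), ν i {e i} ≤
      ENNReal.ofReal ((baseProd b N : ℝ) ^ (-(s : ℝ)) / b N)) :
    (s : ENNReal) ≤ dimH {x | x ∈ Set.Icc (0 : ℝ) 1 ∧ digit b x ∈ G} := by
  have hs0' : (0 : ℝ) < s := hs0
  have hs1' : (s : ℝ) ≤ 1 := hs1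
  set M := Measure.infinitePi ν with hM
  have hpoint : ∀ e ∈ G, M {e} = 0 := by
    intro e he
    have h1 : ∀ r > 0, r ≤ 1 / (baseProd b N₀ : ℝ) → M {e} ≤ ENNReal.ofReal (4 * r ^ (s : ℝ)) := by
      intro r hr hr1
      refine (measure_mono ?_).trans
        (infinitePi_closedBall_le ν hb hGe hs1' hcyl (cantorValue b e) hr hr1)
      rintro _ rfl
      exact ⟨he, Metric.mem_closedBall_self hr.le⟩
    have hlim : Tendsto (fun r : ℝ => ENNReal.ofReal (4 * r ^ (s : ℝ))) (𝓝[>] 0) (𝓝 0) := by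
      rw [← ENNReal.ofReal_zero]
      refine ENNReal.tendsto_ofReal ?_
      have h2 := ((Real.continuousAt_rpow_const 0 (s : ℝ) (Or.inr hs0'.le)).const_mul 4).tendsto
      rw [Real.zero_rpow hs0'.ne', mul_zero] at h2
      exact h2.mono_left nhdsWithin_le_nhds
    refine le_antisymm (ge_of_tendsto hlim ?_) (zero_le)
    filter_upwards [Ioc_mem_nhdsGT (show (0 : ℝ) < 1 / baseProd b N₀ from
      one_div_pos.2 (baseProd_pos hb N₀))] with r hr
    exact h1 r hr.1 hr.2
  set EM : Set (ℕ → ℕ) := {e | ∀ᶠ i in atTop, e i = b i - 1} with hEM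
  have hEMc : EM.Countable := countable_setOf_eventually_eq _
  have hnull : M (G ∩ EM) = 0 := by
    have hc : (G ∩ EM).Countable := hEMc.mono Set.inter_subset_right
    rw [← Set.biUnion_of_singleton (G ∩ EM)]
    exact (measure_biUnion_null_iff hc).2 fun e he => hpoint e he.1
  set G' := G \ EM with hG'
  have hG'm : MeasurableSet G' := hG.diff hEMc.measurableSet
  have hG'0 : M G' ≠ 0 := by
    intro h
    refine hG0 (le_antisymm ?_ (zero_le))
    calc M G ≤ M (G ∩ EM) + M (G \ EM) := measure_le_inter_add_sdiff M G EM
      _ = 0 := by rw [hnull, h, add_zero]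
  set V : (ℕ → ℕ) → ℝ := fun e => cantorValue b fun i => min (e i) (b i - 1) with hV
  have hVm : Measurable V := measurable_cantorValue_min hb
  have hVG : ∀ e ∈ G, V e = cantorValue b e := by
    intro e he
    simp only [hV]
    congr 1
    funext i
    have := hGe e he i
    omega
  have himage : V '' G' ⊆ {x | x ∈ Set.Icc (0 : ℝ) 1 ∧ digit b x ∈ G} := by
    rintro _ ⟨e, he, rfl⟩
    rw [hVG e he.1]
    have hfr : ∃ᶠ i in atTop, e i + 1 < b i := by
      refine (not_eventually.1 he.2).mono fun i hi => ?_
      have := hGe e he.1 i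
      omega
    refine ⟨Set.Ico_subset_Icc_self (cantorValue_mem_Ico hb (hGe e he.1) hfr), ?_⟩
    rw [digit_cantorValue hb (hGe e he.1) hfr]
    exact he.1
  refine le_trans ?_ (dimH_mono himage)
  -- The factor `1/4` absorbs the constant of the ball estimate, so `μ` lies below Hausdorff measure
  -- itself.
  set μ : Measure ℝ := (4 : ENNReal)⁻¹ • (M.restrict G').map V with hμ
  have hball : ∀ x r : ℝ, 0 < r → r ≤ 1 / baseProd b N₀ →
      μ (Metric.closedBall x r) ≤ ENNReal.ofReal (r ^ (s : ℝ)) := by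
    intro x r hr hr1
    rw [hμ, Measure.smul_apply, Measure.map_apply hVm Metric.isClosed_closedBall.measurableSet,
      Measure.restrict_apply (hVm Metric.isClosed_closedBall.measurableSet), smul_eq_mul]
    have h1 : M (V ⁻¹' Metric.closedBall x r ∩ G') ≤ ENNReal.ofReal (4 * r ^ (s : ℝ)) := by
      refine (measure_mono ?_).trans (infinitePi_closedBall_le ν hb hGe hs1' hcyl x hr hr1)
      rintro e ⟨h1, h2⟩
      refine ⟨h2.1, ?_⟩
      rw [Set.mem_ofPred_eq, ← hVG e h2.1]
      exact h1
    calc (4 : ENNReal)⁻¹ * M (V ⁻¹' Metric.closedBall x r ∩ G')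
        ≤ (4 : ENNReal)⁻¹ * ENNReal.ofReal (4 * r ^ (s : ℝ)) := by gcongr
      _ = ENNReal.ofReal (r ^ (s : ℝ)) := by
        rw [ENNReal.ofReal_mul (by norm_num), ← mul_assoc,
          show ENNReal.ofReal 4 = 4 by simp, ENNReal.inv_mul_cancel (by norm_num) (by norm_num),
          one_mul]
  have hle : μ ≤ Measure.hausdorffMeasure (s : ℝ) := by
    refine Measure.le_hausdorffMeasure _ μ (ENNReal.ofReal (1 / baseProd b N₀))
      (ENNReal.ofReal_pos.2 (one_div_pos.2 (baseProd_pos hb N₀))) fun U hU => ?_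
    rcases U.eq_empty_or_nonempty with rfl | ⟨x, hx⟩
    · simp
    have hfin : Metric.ediam U ≠ ⊤ := ne_top_of_le_ne_top ENNReal.ofReal_ne_top hU
    have hUr : ∀ r : ℝ, Metric.ediam U ≤ ENNReal.ofReal r → 0 ≤ r →
        U ⊆ Metric.closedBall x r := by
      intro r hr hr0 y hy
      have h1 := (Metric.edist_le_ediam_of_mem hy hx).trans hr
      rwa [edist_dist, ENNReal.ofReal_le_ofReal_iff hr0] at h1
    rcases eq_or_ne (Metric.ediam U) 0 with h0 | h0
    · rw [h0, ENNReal.zero_rpow_of_pos hs0']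
      have hlim : Tendsto (fun r : ℝ => ENNReal.ofReal (r ^ (s : ℝ))) (𝓝[>] 0) (𝓝 0) := by
        rw [← ENNReal.ofReal_zero]
        refine ENNReal.tendsto_ofReal ?_
        have h2 := (Real.continuousAt_rpow_const 0 (s : ℝ) (Or.inr hs0'.le)).tendsto
        rw [Real.zero_rpow hs0'.ne'] at h2
        exact h2.mono_left nhdsWithin_le_nhds
      refine ge_of_tendsto hlim ?_
      filter_upwards [Ioc_mem_nhdsGT (show (0 : ℝ) < 1 / baseProd b N₀ from
        one_div_pos.2 (baseProd_pos hb N₀))] with r hr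
      exact (measure_mono (hUr r (by rw [h0]; exact zero_le) hr.1.le)).trans
        (hball x r hr.1 hr.2)
    · have hpos : 0 < (Metric.ediam U).toReal := ENNReal.toReal_pos h0 hfin
      have hd : ENNReal.ofReal (Metric.ediam U).toReal = Metric.ediam U :=
        ENNReal.ofReal_toReal hfin
      have h1 : (Metric.ediam U).toReal ≤ 1 / baseProd b N₀ :=
        ENNReal.toReal_le_of_le_ofReal (by positivity) hU
      refine (measure_mono (hUr _ hd.ge hpos.le)).trans ((hball x _ hpos h1).trans_eq ?_)
      rw [← ENNReal.ofReal_rpow_of_pos hpos, hd]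
  refine le_dimH_of_hausdorffMeasure_ne_zero fun h => hG'0 ?_
  have h1 : μ (V '' G') = 0 := le_antisymm ((hle _).trans_eq h) (zero_le)
  rw [hμ, Measure.smul_apply, smul_eq_mul, mul_eq_zero] at h1
  have h2 := h1.resolve_left (by simp)
  -- This inequality does not require the image `V '' G'` to be measurable.
  have h3 := Measure.le_map_apply_image (μ := M.restrict G') hVm.aemeasurable G'
  rw [h2, Measure.restrict_apply_self] at h3
  exact le_antisymm h3 (zero_le)

end Mass

open ProbabilityTheory

/-! ### A law of large numbers for product measures -/

section LawOfLargeNumbers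

variable (ν : ℕ → Measure ℕ) [∀ i, IsProbabilityMeasure (ν i)]

theorem integral_indicator_infinitePi (A : Set ℕ) (i : ℕ) :
    ∫ e, A.indicator (fun _ => (1 : ℝ)) (e i) ∂(Measure.infinitePi ν) = (ν i).real A := by
  have h := integral_map (μ := Measure.infinitePi ν) (φ := fun e => e i)
    (measurable_pi_apply i).aemeasurable
    (f := A.indicator fun _ => (1 : ℝ)) (measurable_from_nat.aestronglyMeasurable)
  rw [← h, Measure.infinitePi_map_eval, integral_indicator_const _ (MeasurableSet.of_discrete)]
  simp

/-- Hoeffding's inequality bounds the exceptional probabilities by `exp (-2 ε² N)`, and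
Borel–Cantelli applies. The laws `ν i` may differ from one position to the next. Complements then
give the other side in `ae_tendsto_average`. -/
theorem ae_eventually_sum_lt (A : ℕ → Set ℕ) {ε : ℝ} (hε : 0 < ε) :
    ∀ᵐ e ∂(Measure.infinitePi ν), ∀ᶠ N : ℕ in atTop,
      ∑ i ∈ range N, ((A i).indicator (fun _ => (1 : ℝ)) (e i) - (ν i).real (A i)) < ε * N := by
  set M := Measure.infinitePi ν with hM
  set X : ℕ → (ℕ → ℕ) → ℝ := fun i e =>
    (A i).indicator (fun _ => (1 : ℝ)) (e i) - (ν i).real (A i) with hX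
  have hind : iIndepFun X M :=
    iIndepFun_infinitePi (P := ν)
      (X := fun i k => (A i).indicator (fun _ => (1 : ℝ)) k - (ν i).real (A i))
      fun i => measurable_from_nat
  have hsub : ∀ i, HasSubgaussianMGF (X i) ((‖(1 : ℝ) - 0‖₊ / 2) ^ 2) M := by
    intro i
    have h := hasSubgaussianMGF_of_mem_Icc (μ := M)
      (X := fun e => (A i).indicator (fun _ => (1 : ℝ)) (e i)) (a := 0) (b := 1)
      (((measurable_from_nat (f := (A i).indicator fun _ => (1 : ℝ))).comp
        (measurable_pi_apply i)).aemeasurable)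
      (Eventually.of_forall fun e => by
        by_cases h : e i ∈ A i <;> simp [h])
    rwa [hM, integral_indicator_infinitePi] at h
  have hbound : ∀ N : ℕ, M {e | ε * N ≤ ∑ i ∈ range N, X i e} ≤
      ENNReal.ofReal (Real.exp (-(2 * ε ^ 2)) ^ N) := by
    intro N
    have h := HasSubgaussianMGF.measure_sum_range_ge_le_of_iIndepFun hind (n := N)
      (fun i _ => hsub i) (ε := ε * N) (by positivity)
    rw [← ofReal_measureReal]
    refine ENNReal.ofReal_le_ofReal (h.trans_eq ?_)
    rw [← Real.exp_nat_mul]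
    congr 1
    rcases Nat.eq_zero_or_pos N with rfl | hN
    · simp
    · have hN' : (N : ℝ) ≠ 0 := by positivity
      simp
      field_simp
  have hsum : ∑' N : ℕ, M {e | ε * N ≤ ∑ i ∈ range N, X i e} ≠ ⊤ := by
    refine ne_top_of_le_ne_top ?_ (ENNReal.tsum_le_tsum hbound)
    have hs : Summable fun N : ℕ => Real.exp (-(2 * ε ^ 2)) ^ N :=
      summable_geometric_of_lt_one (Real.exp_pos _).le (by
        rw [Real.exp_lt_one_iff]
        have : 0 < ε ^ 2 := by positivity
        linarith)
    exact hs.tsum_ofReal_ne_top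
  filter_upwards [ae_eventually_notMem hsum] with e he
  filter_upwards [he] with N hN
  exact not_le.1 hN

theorem ae_tendsto_average (A : ℕ → Set ℕ) :
    ∀ᵐ e ∂(Measure.infinitePi ν), Tendsto (fun N : ℕ => (∑ i ∈ range N,
      ((A i).indicator (fun _ => (1 : ℝ)) (e i) - (ν i).real (A i))) / N) atTop (𝓝 0) := by
  have h1 : ∀ᵐ e ∂(Measure.infinitePi ν), ∀ m : ℕ, ∀ᶠ N : ℕ in atTop,
      ∑ i ∈ range N, ((A i).indicator (fun _ => (1 : ℝ)) (e i) - (ν i).real (A i)) <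
        1 / (m + 1 : ℝ) * N :=
    ae_all_iff.2 fun m => ae_eventually_sum_lt ν A (by positivity)
  have h2 : ∀ᵐ e ∂(Measure.infinitePi ν), ∀ m : ℕ, ∀ᶠ N : ℕ in atTop,
      ∑ i ∈ range N, ((A i)ᶜ.indicator (fun _ => (1 : ℝ)) (e i) - (ν i).real (A i)ᶜ) <
        1 / (m + 1 : ℝ) * N :=
    ae_all_iff.2 fun m => ae_eventually_sum_lt ν (fun i => (A i)ᶜ) (by positivity)
  filter_upwards [h1, h2] with e he1 he2
  have hneg : ∀ i, (A i)ᶜ.indicator (fun _ => (1 : ℝ)) (e i) - (ν i).real (A i)ᶜ =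
      -((A i).indicator (fun _ => (1 : ℝ)) (e i) - (ν i).real (A i)) := by
    intro i
    rw [probReal_compl_eq_one_sub MeasurableSet.of_discrete]
    by_cases h : e i ∈ A i <;> simp [h]
  simp_rw [hneg, Finset.sum_neg_distrib] at he2
  rw [Metric.tendsto_atTop']
  intro ε hε
  obtain ⟨m, hm⟩ := exists_nat_one_div_lt hε
  obtain ⟨N₀, hN₀⟩ := eventually_atTop.1 ((he1 m).and (he2 m))
  refine ⟨N₀, fun N hN => ?_⟩
  have h3 := hN₀ N hN.le
  have hNpos : (0 : ℝ) < N := by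
    have : 0 < N := by omega
    exact_mod_cast this
  rw [Real.dist_eq, sub_zero, abs_div, abs_of_pos hNpos, div_lt_iff₀ hNpos, abs_lt]
  have h4 : 1 / (m + 1 : ℝ) * N < ε * N := by gcongr
  constructor <;> linarith [h3.1, h3.2]

end LawOfLargeNumbers

/-- Statements that hold eventually for each `k` hold along some slow sequence `m N → ∞`. -/
theorem exists_slow_sequence {Q : ℕ → ℕ → Prop} (hQ : ∀ k, ∀ᶠ N in atTop, Q k N) :
    ∃ m : ℕ → ℕ, Monotone m ∧ Tendsto m atTop atTop ∧ ∀ᶠ N in atTop, Q (m N) N := by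
  choose f hf using fun k => eventually_atTop.1 (hQ k)
  -- The summand `k` makes `g k ≤ N` imply `k ≤ N`, as `findGreatest` requires; the partial sums
  -- dominate `f` and give `g 0 ≤ g k`.
  set g : ℕ → ℕ := fun k => k + ∑ i ∈ range (k + 1), f i with hg
  have hgk : ∀ k, k ≤ g k := fun k => Nat.le_add_right _ _
  have hgf : ∀ k, f k ≤ g k := fun k =>
    (Finset.single_le_sum (fun _ _ => Nat.zero_le _) (Finset.self_mem_range_succ k)).trans
      (Nat.le_add_left _ _)
  have hspec : ∀ N, g 0 ≤ N → g (Nat.findGreatest (fun k => g k ≤ N) N) ≤ N := fun N hN =>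
    Nat.findGreatest_spec (P := fun k => g k ≤ N) (Nat.zero_le N) hN
  have hle : ∀ N k, g k ≤ N → k ≤ Nat.findGreatest (fun k => g k ≤ N) N := fun N k hk =>
    Nat.le_findGreatest ((hgk k).trans hk) hk
  refine ⟨fun N => Nat.findGreatest (fun k => g k ≤ N) N, fun N N' hN => ?_, ?_, ?_⟩
  · rcases le_or_gt (g 0) N with h | h
    · exact hle N' _ ((hspec N h).trans hN)
    · have : Nat.findGreatest (fun k => g k ≤ N) N = 0 := by
        rw [Nat.findGreatest_eq_zero_iff]
        intro k _ _ hk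
        have h1 : g 0 ≤ g k := by
          simp only [hg]
          gcongr
        omega
      simp [this]
  · exact tendsto_atTop.2 fun k => (eventually_ge_atTop (g k)).mono fun N hN => hle N k hN
  · filter_upwards [eventually_ge_atTop (g 0)] with N hN
    exact hf _ _ ((hgf _).trans (hspec N hN))

/-! ### Random digits with slowly growing thresholds, and the lower bound for `J_A(P)` -/

section Lower

variable {b : ℕ → ℕ} {d : ℕ → ℝ} {P : ℕ → ℕ → ℝ}

/-- Digits with law `P (b i)` if the base `b i` is at most `m i`, and uniform digits
otherwise. -/
noncomputable def slowWeight (b : ℕ → ℕ) (P : ℕ → ℕ → ℝ) (m : ℕ → ℕ) (i j : ℕ) : ℝ :=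
  if b i ≤ m i then P (b i) j else if j < b i then (b i : ℝ)⁻¹ else 0

theorem slowWeight_nonneg (hb : ∀ i, 2 ≤ b i) (hP : P ∈ stochMatrices) (m : ℕ → ℕ) (i j : ℕ) :
    0 ≤ slowWeight b P m i j := by
  unfold slowWeight
  split_ifs
  · exact (hP _ (hb i)).1 j
  · positivity
  · exact le_rfl

theorem slowWeight_le_one (hb : ∀ i, 2 ≤ b i) (hP : P ∈ stochMatrices) (m : ℕ → ℕ) (i j : ℕ) :
    slowWeight b P m i j ≤ 1 := by
  unfold slowWeight
  split_ifs
  · exact stochMatrices_le_one hP (hb i) j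
  · refine inv_le_one_of_one_le₀ ?_
    have := hb i
    have : 1 ≤ b i := by omega
    exact_mod_cast this
  · exact zero_le_one

theorem slowWeight_eq_zero (hb : ∀ i, 2 ≤ b i) (hP : P ∈ stochMatrices) (m : ℕ → ℕ) {i j : ℕ}
    (hj : b i ≤ j) : slowWeight b P m i j = 0 := by
  unfold slowWeight
  split_ifs
  · exact (hP _ (hb i)).2.1 j hj
  · omega
  · rfl

theorem sum_slowWeight (hb : ∀ i, 2 ≤ b i) (hP : P ∈ stochMatrices) (m : ℕ → ℕ) (i : ℕ) :
    ∑ j ∈ range (b i), slowWeight b P m i j = 1 := by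
  unfold slowWeight
  split_ifs
  · exact (hP _ (hb i)).2.2
  · rw [Finset.sum_congr rfl fun j hj => if_pos (Finset.mem_range.1 hj), Finset.sum_const,
      Finset.card_range, nsmul_eq_mul, mul_inv_cancel₀]
    have := hb i
    have : b i ≠ 0 := by omega
    exact_mod_cast this

/-- The law of the `i`-th digit. -/
noncomputable def digitLaw (hb : ∀ i, 2 ≤ b i) (hP : P ∈ stochMatrices) (m : ℕ → ℕ) (i : ℕ) :
    PMF ℕ :=
  PMF.ofFinset (fun j => ENNReal.ofReal (slowWeight b P m i j)) (range (b i))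
    (by rw [← ENNReal.ofReal_sum_of_nonneg fun j _ => slowWeight_nonneg hb hP m i j,
          sum_slowWeight hb hP, ENNReal.ofReal_one])
    (fun j hj => by
      rw [slowWeight_eq_zero hb hP m (by simpa using hj), ENNReal.ofReal_zero])

theorem digitLaw_singleton (hb : ∀ i, 2 ≤ b i) (hP : P ∈ stochMatrices) (m : ℕ → ℕ) (i j : ℕ) :
    (digitLaw hb hP m i).toMeasure {j} = ENNReal.ofReal (slowWeight b P m i j) := by
  rw [PMF.toMeasure_apply_singleton _ _ (measurableSet_singleton j)]
  rfl

theorem ae_slowWeight_pos (hb : ∀ i, 2 ≤ b i) (hP : P ∈ stochMatrices) (m : ℕ → ℕ) :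
    ∀ᵐ e ∂(Measure.infinitePi fun i => (digitLaw hb hP m i).toMeasure),
      ∀ i, 0 < slowWeight b P m i (e i) := by
  refine ae_all_iff.2 fun i => ?_
  have h : ∀ᵐ k ∂(digitLaw hb hP m i).toMeasure, 0 < slowWeight b P m i k := by
    rw [ae_iff, PMF.toMeasure_apply_eq_zero_iff _ MeasurableSet.of_discrete, Set.disjoint_left]
    intro k hk hk'
    rw [PMF.mem_support_iff] at hk
    have h1 : slowWeight b P m i k ≤ 0 := not_lt.1 hk'
    exact hk (ENNReal.ofReal_eq_zero.2 h1)
  rw [← Measure.infinitePi_map_eval (fun i => (digitLaw hb hP m i).toMeasure) i] at h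
  exact ae_of_ae_map (measurable_pi_apply i).aemeasurable h

/-- A fixed base `n` is eventually below the threshold `m i`, so its digits have law `P n` up to
finitely many positions. The law of large numbers and a Cesàro argument then give the frequency. -/
theorem ae_tendsto_pairCount (hb : ∀ i, 2 ≤ b i) (hd : IsBaseFrequency b d)
    (hP : P ∈ stochMatrices) {m : ℕ → ℕ} (hm : Tendsto m atTop atTop) :
    ∀ᵐ e ∂(Measure.infinitePi fun i => (digitLaw hb hP m i).toMeasure),
      ∀ n j, Tendsto (fun N : ℕ => (pairCount b e N n j : ℝ) / N) atTop (𝓝 (d n * P n j)) := by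
  refine ae_all_iff.2 fun n => ae_all_iff.2 fun j => ?_
  filter_upwards [ae_tendsto_average (fun i => (digitLaw hb hP m i).toMeasure)
    (fun i => if b i = n then {j} else ∅)] with e he
  have hdiff : Tendsto (fun i => if b i = n then slowWeight b P m i j - P n j else 0) atTop
      (𝓝 0) := by
    refine tendsto_const_nhds.congr' ?_
    filter_upwards [hm.eventually_ge_atTop n] with i hi
    split_ifs with h
    · rw [slowWeight, if_pos (by omega), h, sub_self]
    · rfl
  have h1 := (he.add hdiff.cesaro).add ((hd n).mul_const (P n j))
  rw [zero_add, zero_add] at h1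
  refine h1.congr fun N => ?_
  have h2 : (pairCount b e N n j : ℝ) = ∑ i ∈ range N, if b i = n ∧ e i = j then (1 : ℝ) else 0 := by
    rw [pairCount, Finset.card_filter]
    push_cast
    rfl
  have h3 : (baseCount b n N : ℝ) = ∑ i ∈ range N, if b i = n then (1 : ℝ) else 0 := by
    rw [baseCount, Finset.card_filter]
    push_cast
    rfl
  rw [h2, h3, div_mul_eq_mul_div, Finset.sum_mul, inv_mul_eq_div, ← add_div, ← add_div,
    ← Finset.sum_add_distrib, ← Finset.sum_add_distrib]
  congr 1
  refine Finset.sum_congr rfl fun i _ => ?_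
  by_cases h : b i = n
  · have h4 : ((digitLaw hb hP m i).toMeasure).real {j} = slowWeight b P m i j := by
      rw [Measure.real, digitLaw_singleton, ENNReal.toReal_ofReal (slowWeight_nonneg hb hP m i j)]
    simp only [h, if_true, h4, true_and]
    by_cases h5 : e i = j
    · simp [h5]
    · simp [h5]
      ring
  · simp [h]

/-- Leaves a deterministic estimate to verify: `H` is the logarithm of the cylinder bound in
`le_dimH_of_cylinder_le`, required only along typical digit sequences. -/
theorem le_dimH_jointLevelSet (hb : ∀ i, 2 ≤ b i) (hd : IsBaseFrequency b d)
    (hP : P ∈ stochMatrices) {m : ℕ → ℕ} (hm : Tendsto m atTop atTop) {s : NNReal}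
    (hs0 : 0 < s) (hs1 : s ≤ 1)
    (H : ∀ e : ℕ → ℕ, (∀ i, e i < b i) → (∀ i, 0 < slowWeight b P m i (e i)) →
      (∀ n j, Tendsto (fun N : ℕ => (pairCount b e N n j : ℝ) / N) atTop (𝓝 (d n * P n j))) →
      ∀ᶠ N in atTop, ∑ i ∈ range (N + 1), (Real.log (b i) +
        Real.log (slowWeight b P m i (e i))) ≤ (1 - s) * Real.log (baseProd b N)) :
    (s : ENNReal) ≤ dimH (jointLevelSet b d P) := by
  set ν : ℕ → Measure ℕ := fun i => (digitLaw hb hP m i).toMeasure with hν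
  obtain ⟨t, hts, htm, htn⟩ := exists_measurable_superset_of_null
    (ae_iff.1 ((ae_slowWeight_pos hb hP m).and (ae_tendsto_pairCount hb hd hP hm)))
  have hgood : ∀ e ∈ tᶜ, (∀ i, 0 < slowWeight b P m i (e i)) ∧
      ∀ n j, Tendsto (fun N : ℕ => (pairCount b e N n j : ℝ) / N) atTop (𝓝 (d n * P n j)) := by
    intro e he
    by_contra h
    exact he (hts h)
  have hlt : ∀ e ∈ tᶜ, ∀ i, e i < b i := by
    intro e he i
    by_contra h
    have := (hgood e he).1 i
    rw [slowWeight_eq_zero hb hP m (not_lt.1 h)] at this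
    exact lt_irrefl _ this
  -- The cylinder bound starts at a random order; some `G N₀` has positive measure because they
  -- cover a set of full measure.
  set G : ℕ → Set (ℕ → ℕ) := fun N₀ => tᶜ ∩ ⋂ N, ⋂ _ : N₀ ≤ N,
    {e | ∏ i ∈ range (N + 1), slowWeight b P m i (e i) ≤
      (baseProd b N : ℝ) ^ (-(s : ℝ)) / b N} with hG
  have hGm : ∀ N₀, MeasurableSet (G N₀) := by
    intro N₀
    refine htm.compl.inter (MeasurableSet.iInter fun N => MeasurableSet.iInter fun _ => ?_)
    refine measurableSet_le (Finset.measurable_prod _ fun i _ => ?_) measurable_const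
    exact (measurable_from_nat (f := slowWeight b P m i)).comp (measurable_pi_apply i)
  have hcov : tᶜ ⊆ ⋃ N₀, G N₀ := by
    intro e he
    obtain ⟨N₀, hN₀⟩ := eventually_atTop.1 (H e (hlt e he) (hgood e he).1 (hgood e he).2)
    refine Set.mem_iUnion.2 ⟨N₀, he, Set.mem_iInter₂.2 fun N hN => ?_⟩
    have h1 := hN₀ N hN
    have hbN : (0 : ℝ) < b N := by
      have := hb N
      have : 0 < b N := by omega
      exact_mod_cast this
    have hq := baseProd_pos hb N
    have hprod : 0 < ∏ i ∈ range (N + 1), slowWeight b P m i (e i) :=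
      Finset.prod_pos fun i _ => (hgood e he).1 i
    rw [Set.mem_ofPred_eq, ← Real.log_le_log_iff hprod (by positivity),
      Real.log_div (by positivity) hbN.ne', Real.log_rpow hq,
      Real.log_prod fun i _ => ((hgood e he).1 i).ne']
    rw [Finset.sum_add_distrib, Finset.sum_range_succ (fun i => Real.log (b i)),
      ← log_baseProd hb] at h1
    linarith
  obtain ⟨N₀, hN₀⟩ : ∃ N₀, Measure.infinitePi ν (G N₀) ≠ 0 := by
    by_contra! h
    have h1 : Measure.infinitePi ν tᶜ = 0 := measure_mono_null hcov (measure_iUnion_null h)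
    have h2 : Measure.infinitePi ν Set.univ ≤ 0 := by
      rw [← Set.union_compl_self t]
      refine (measure_union_le _ _).trans ?_
      rw [htn, h1, add_zero]
    rw [measure_univ] at h2
    exact absurd h2 (by simp)
  refine (le_dimH_of_cylinder_le ν hb (hGm N₀) hN₀ (fun e he => hlt e he.1) hs0 hs1 (N₀ := N₀)
    fun e he N hN => ?_).trans (dimH_mono ?_)
  · simp only [hν, digitLaw_singleton]
    rw [← ENNReal.ofReal_prod_of_nonneg fun i _ => slowWeight_nonneg hb hP m i _]
    exact ENNReal.ofReal_le_ofReal (Set.mem_iInter₂.1 he.2 N hN)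
  · rintro x ⟨hx, hxG⟩
    exact ⟨hx, fun k _ j _ => (hgood _ hxG.1).2 k j⟩

end Lower

/-! ### Comparison of the two bounds and the dimension formula -/

section Dimension

variable {b : ℕ → ℕ} {d α : ℕ → ℝ} {P : ℕ → ℕ → ℝ}

theorem mul_log_two_le_log_baseProd (hb : ∀ i, 2 ≤ b i) (N : ℕ) :
    N * Real.log 2 ≤ Real.log (baseProd b N) := by
  rw [← Real.log_pow]
  exact Real.log_le_log (by positivity) (two_pow_le_baseProd hb N)

theorem log_base_nonneg (b : ℕ → ℕ) (i : ℕ) : 0 ≤ Real.log (b i) :=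
  Real.log_natCast_nonneg _

theorem tendsto_sum_smallBases (hd : IsBaseFrequency b d) (K : ℕ) :
    Tendsto (fun N : ℕ => (∑ i ∈ range N, if b i < K then Real.log (b i) else 0) / (N : ℝ)) atTop
      (𝓝 (∑ n ∈ range K, d n * Real.log n)) := by
  have h := tendsto_average_of_frequency b (range K) d (fun n => Real.log n) fun n _ => hd n
  simpa only [Finset.mem_range] using h

/-- If the mean logarithm of the bases tends to infinity, then all joint level sets have full
dimension. -/
theorem one_le_dimH_jointLevelSet (hb : ∀ i, 2 ≤ b i) (hd : IsBaseFrequency b d)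
    (hP : P ∈ stochMatrices)
    (hh : Tendsto (fun N : ℕ => Real.log (baseProd b N) / N) atTop atTop) :
    1 ≤ dimH (jointLevelSet b d P) := by
  refine le_of_forall_lt fun c hc => ?_
  obtain ⟨s, hcs, hs1⟩ := ENNReal.lt_iff_exists_nnreal_btwn.1 hc
  have hs1' : (s : ℝ) < 1 := by exact_mod_cast hs1
  have hs0 : 0 < s := by
    have := zero_le.trans_lt hcs
    exact_mod_cast this
  refine hcs.trans_le ?_
  -- Each position contributes at most `log (m N)`, as uniform digits contribute zero; `m` is chosen
  -- so slow that the total stays below `(1 - s) log B_N`.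
  have hQ : ∀ k : ℕ, ∀ᶠ N : ℕ in atTop,
      ((N : ℝ) + 1) * Real.log k ≤ (1 - s) * Real.log (baseProd b N) := by
    intro k
    filter_upwards [hh.eventually_ge_atTop (2 * Real.log k / (1 - s)), eventually_gt_atTop 0]
      with N hN hN0
    have h1 : (1 : ℝ) ≤ N := by exact_mod_cast hN0
    have h2 : 0 < 1 - (s : ℝ) := sub_pos.2 hs1'
    rw [div_le_div_iff₀ h2 (by linarith)] at hN
    have h3 := Real.log_natCast_nonneg k
    nlinarith
  obtain ⟨m, hmono, hm, hmQ⟩ := exists_slow_sequence hQ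
  refine le_dimH_jointLevelSet hb hd hP hm hs0 (by exact_mod_cast hs1.le) fun e he hpos _ => ?_
  filter_upwards [hmQ] with N hN
  refine le_trans ?_ hN
  have hY : ∀ i ∈ range (N + 1), Real.log (b i) + Real.log (slowWeight b P m i (e i)) ≤
      Real.log (m N) := by
    intro i hi
    have hi' : i ≤ N := by
      have := Finset.mem_range.1 hi
      omega
    by_cases h : b i ≤ m i
    · have h1 := Real.log_nonpos (hpos i).le (slowWeight_le_one hb hP m i _)
      have h2 : Real.log (b i) ≤ Real.log (m N) := by
        refine Real.log_le_log ?_ (by exact_mod_cast h.trans (hmono hi'))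
        have := hb i
        have : 0 < b i := by omega
        exact_mod_cast this
      linarith
    · rw [slowWeight, if_neg h, if_pos (he i), Real.log_inv, add_neg_cancel]
      exact Real.log_natCast_nonneg _
  refine (Finset.sum_le_sum hY).trans_eq ?_
  rw [Finset.sum_const, Finset.card_range, nsmul_eq_mul]
  push_cast
  rfl

theorem tendsto_sum_smallBases_log {e : ℕ → ℕ} (he : ∀ i, e i < b i)
    (hfreq : ∀ n j, Tendsto (fun N : ℕ => (pairCount b e N n j : ℝ) / N) atTop
      (𝓝 (d n * P n j))) (hd2 : ∀ n < 2, d n = 0) (hP : P ∈ stochMatrices) (K : ℕ) :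
    Tendsto (fun N : ℕ => (∑ i ∈ range N, if b i < K then
      Real.log (b i) + Real.log (P (b i) (e i)) else 0) / (N : ℝ)) atTop
      (𝓝 (∑ n ∈ range K, (d n * Real.log n - d n * rowEntropy P n))) := by
  have h1 : ∀ N : ℕ, ∑ i ∈ range N, (if b i < K then
      Real.log (b i) + Real.log (P (b i) (e i)) else 0) = ∑ n ∈ range K, ∑ j ∈ range n,
      (pairCount b e N n j : ℝ) * (if n < K then Real.log n + Real.log (P n j) else 0) :=
    sum_eq_sum_pairCount b he (fun n j => if n < K then Real.log n + Real.log (P n j) else 0)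
      fun n hn j _ => if_neg (by omega)
  have h2 := tendsto_finsetSum (range K) fun n _ => tendsto_finsetSum (range n) fun j _ =>
    (hfreq n j).mul_const (if n < K then Real.log n + Real.log (P n j) else 0)
  have h3 : ∑ n ∈ range K, ∑ j ∈ range n,
      d n * P n j * (if n < K then Real.log n + Real.log (P n j) else 0) =
      ∑ n ∈ range K, (d n * Real.log n - d n * rowEntropy P n) := by
    refine Finset.sum_congr rfl fun n hn => ?_
    rw [← mul_sub]
    rcases lt_or_ge n 2 with h | h
    · simp [hd2 n h]
    · simp_rw [if_pos (Finset.mem_range.1 hn), mul_add, Finset.sum_add_distrib]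
      rw [← Finset.sum_mul, ← Finset.mul_sum, (hP n h).2.2, rowEntropy, mul_sub, Finset.mul_sum,
        mul_one, sub_eq_add_neg, ← Finset.sum_neg_distrib]
      congr 1
      refine Finset.sum_congr rfl fun j _ => ?_
      rw [Real.negMulLog]
      ring
  rw [h3] at h2
  refine h2.congr fun N => ?_
  rw [h1, Finset.sum_div]
  refine Finset.sum_congr rfl fun n _ => ?_
  rw [Finset.sum_div]
  exact Finset.sum_congr rfl fun j _ => by ring

/-- Bases below a fixed `K` contribute at most `H - E` on average in the limit, by the joint
frequencies. Bases from `K` to the threshold contribute at most their mean logarithm, which the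
choice of `m` keeps close to the tail of `H`. Bases above the threshold contribute zero. -/
theorem le_dimH_jointLevelSet_of_summable (hb : ∀ i, 2 ≤ b i) (hd : IsBaseFrequency b d)
    (hP : P ∈ stochMatrices) (hs : Summable fun n : ℕ => d n * Real.log n) {κ : ℝ}
    (hκ : ∑' n : ℕ, d n * Real.log n - ∑' n, d n * rowEntropy P n < κ) {s : NNReal} (hs1 : s ≤ 1)
    (hev : ∀ᶠ N : ℕ in atTop, κ * (N + 1) ≤ (1 - s) * Real.log (baseProd b N)) :
    (s : ENNReal) ≤ dimH (jointLevelSet b d P) := by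
  rcases eq_or_ne s 0 with rfl | hs0
  · simp
  have hd0 := baseFrequency_nonneg hd
  have hd2 : ∀ n < 2, d n = 0 := fun n hn => baseFrequency_eq_zero hb hd hn
  have hsE := summable_mul_rowEntropy hd0 hd2 hP hs
  set H := ∑' n : ℕ, d n * Real.log n with hH
  set E := ∑' n, d n * rowEntropy P n with hE
  have hterm : ∀ n : ℕ, 0 ≤ d n * Real.log n := fun n =>
    mul_nonneg (hd0 n) (Real.log_natCast_nonneg n)
  have hQ : ∀ k : ℕ, ∀ᶠ N : ℕ in atTop,
      (∑ i ∈ range (N + 1), if b i < k + 1 then Real.log (b i) else 0) / ((N + 1 : ℕ) : ℝ) ≤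
        H + 1 / (k + 1 : ℝ) := by
    intro k
    have h1 := (tendsto_sum_smallBases hd (k + 1)).comp (tendsto_add_atTop_nat 1)
    refine (h1.eventually (gt_mem_nhds ?_)).mono fun N hN => le_of_lt hN
    have h2 := hs.sum_le_tsum (range (k + 1)) fun n _ => hterm n
    have h3 : (0 : ℝ) < 1 / (k + 1 : ℝ) := by positivity
    linarith
  obtain ⟨m, hmono, hm, hmQ⟩ := exists_slow_sequence hQ
  refine le_dimH_jointLevelSet hb hd hP hm (pos_iff_ne_zero.2 hs0) hs1 fun e he hpos hfreq => ?_
  obtain ⟨K, hK⟩ := (hs.hasSum.tendsto_sum_nat.eventually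
    (lt_mem_nhds (sub_lt_self H (sub_pos.2 hκ)))).exists
  set Y : ℕ → ℝ := fun i => Real.log (b i) + Real.log (slowWeight b P m i (e i)) with hY
  set F : ℕ → ℝ := fun i => if b i < K then Real.log (b i) + Real.log (P (b i) (e i)) else 0 with hF
  set S : ℕ → ℝ := fun i => if b i < K then Real.log (b i) else 0 with hS
  -- A correction for the finitely many positions whose threshold has not reached `K`; its average
  -- tends to zero.
  set R : ℕ → ℝ := fun i => if K ≤ m i then 0 else |Y i - F i| with hR
  have hRlim : Tendsto R atTop (𝓝 0) := by
    refine tendsto_const_nhds.congr' ?_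
    filter_upwards [hm.eventually_ge_atTop K] with i hi
    simp [hR, hi]
  have hmlim : Tendsto (fun N => 1 / ((m N : ℝ) + 1)) atTop (𝓝 0) :=
    tendsto_one_div_add_atTop_nhds_zero_nat.comp hm
  have hlim := (((((tendsto_sum_smallBases_log he hfreq hd2 hP K).comp
    (tendsto_add_atTop_nat 1)).add (hRlim.cesaro.comp (tendsto_add_atTop_nat 1))).sub
    ((tendsto_sum_smallBases hd K).comp (tendsto_add_atTop_nat 1))).add
    (hmlim.const_add H))
  have hlt : ∑ n ∈ range K, (d n * Real.log n - d n * rowEntropy P n) + 0 -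
      ∑ n ∈ range K, d n * Real.log n + (H + 0) < κ := by
    have h1 := (hs.sub hsE).sum_le_tsum (range K) fun n _ =>
      sub_nonneg.2 (mul_rowEntropy_le hd0 hd2 hP n)
    rw [hs.tsum_sub hsE] at h1
    linarith
  filter_upwards [hlim.eventually (gt_mem_nhds hlt), hmQ, hm.eventually_ge_atTop K, hev]
    with N hN1 hN2 hN3 hN4
  refine le_trans ?_ hN4
  have hstep : ∀ i ∈ range (N + 1), Y i ≤ F i + R i - S i +
      (if b i < m N + 1 then Real.log (b i) else 0) := by
    intro i hi
    have hi' : i ≤ N := by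
      have := Finset.mem_range.1 hi
      omega
    have hlog := log_base_nonneg b i
    have hmi := hmono hi'
    have hSle : S i ≤ if b i < m N + 1 then Real.log (b i) else 0 := by
      simp only [hS]
      split_ifs <;> first | omega | linarith
    by_cases hKm : K ≤ m i
    · have hR0 : R i = 0 := if_pos hKm
      by_cases hbK : b i < K
      · have h1 : Y i = F i := by
          simp only [hY, hF]
          rw [if_pos hbK, slowWeight, if_pos (by omega)]
        linarith
      · have h1 : F i = 0 := if_neg hbK
        have h2 : S i = 0 := if_neg hbK
        rw [h1, h2, hR0]
        by_cases hbm : b i ≤ m i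
        · have h3 := Real.log_nonpos (hpos i).le (slowWeight_le_one hb hP m i _)
          rw [if_pos (by omega)]
          simp only [hY]
          linarith
        · have h3 : Y i = 0 := by
            simp only [hY]
            rw [slowWeight, if_neg hbm, if_pos (he i), Real.log_inv, add_neg_cancel]
          rw [h3]
          split_ifs <;> linarith
    · have h1 : R i = |Y i - F i| := if_neg hKm
      have h2 := le_abs_self (Y i - F i)
      linarith
  have hsum : ∑ i ∈ range (N + 1), Y i ≤ ∑ i ∈ range (N + 1), F i + ∑ i ∈ range (N + 1), R i -
      ∑ i ∈ range (N + 1), S i +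
      ∑ i ∈ range (N + 1), (if b i < m N + 1 then Real.log (b i) else 0) := by
    rw [← Finset.sum_add_distrib, ← Finset.sum_sub_distrib, ← Finset.sum_add_distrib]
    exact Finset.sum_le_sum hstep
  have hNpos : (0 : ℝ) < ((N + 1 : ℕ) : ℝ) := by positivity
  simp only [Function.comp_apply, inv_mul_eq_div] at hN1
  refine hsum.trans ?_
  have hcast : ((N + 1 : ℕ) : ℝ) = N + 1 := by push_cast; rfl
  rw [← hcast, ← div_le_iff₀ hNpos, add_div, sub_div, add_div]
  linarith

/-- Along bases with frequently bounded mean logarithm, the frequencies have a finite mean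
logarithm. -/
theorem summable_mul_log_of_frequently (hd : IsBaseFrequency b d) (hb : ∀ i, 2 ≤ b i) {C : ℝ}
    (hfr : ∃ᶠ N : ℕ in atTop, Real.log (baseProd b N) / N ≤ C) :
    Summable fun n : ℕ => d n * Real.log n := by
  have hd0 := baseFrequency_nonneg hd
  refine summable_of_sum_range_le (c := C)
    (fun n => mul_nonneg (hd0 n) (Real.log_natCast_nonneg n)) fun K => ?_
  refine le_of_tendsto_of_frequently (tendsto_sum_smallBases hd K) (hfr.mono fun N hN => ?_)
  refine le_trans ?_ hN
  rw [log_baseProd hb]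
  gcongr with i
  split_ifs
  · exact le_rfl
  · exact log_base_nonneg b i

theorem dimH_le_one_real (S : Set ℝ) : dimH S ≤ 1 :=
  (dimH_mono (Set.subset_univ S)).trans_eq Real.dimH_univ

/-- For `s'` below the dimension of `J_A(α)` the hypothesis of the upper bound must fail, and its
negation, for slightly smaller `s`, is the hypothesis of the lower bound. -/
theorem dimH_levelSet_le_dimH_jointLevelSet (hb : ∀ i, 2 ≤ b i) (hd : IsBaseFrequency b d)
    (hd1 : HasSum d 1) (hα : IsStochastic α) (hne : (admissible d α).Nonempty) :
    dimH (levelSet b α) ≤ dimH (jointLevelSet b d (optMatrix d α)) := by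
  have hd0 := baseFrequency_nonneg hd
  have hd2 : ∀ n < 2, d n = 0 := fun n hn => baseFrequency_eq_zero hb hd hn
  have hS := optMatrix_mem_stochMatrices hα hd0 hd2 hne
  by_cases hh : Tendsto (fun N : ℕ => Real.log (baseProd b N) / N) atTop atTop
  · exact (dimH_le_one_real _).trans (one_le_dimH_jointLevelSet hb hd hS hh)
  have hs : Summable fun n : ℕ => d n * Real.log n := by
    rw [tendsto_atTop] at hh
    push Not at hh
    obtain ⟨C, hC⟩ := hh
    exact summable_mul_log_of_frequently hd hb (hC.mono fun N hN => hN.le)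
  refine le_of_forall_lt fun c hc => ?_
  obtain ⟨s, hcs, hs1⟩ := ENNReal.lt_iff_exists_nnreal_btwn.1 hc
  obtain ⟨s', hss, hs'⟩ := ENNReal.lt_iff_exists_nnreal_btwn.1 hs1
  have hss' : (s : ℝ) < s' := by exact_mod_cast hss
  refine hcs.trans_le ?_
  set D := ∑' n : ℕ, d n * Real.log n - ∑' n, d n * rowEntropy (optMatrix d α) n with hD
  -- As `log B_N ≥ N log 2`, passing from `s'` to `s` gains `3 η N`. This covers the `2 η N` between
  -- `D - η` and `D + η`, and `η N` is left for replacing `N` by `N + 1`.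
  obtain ⟨η, hη0, hη⟩ : ∃ η > 0, 3 * η = (s' - s) * Real.log 2 :=
    ⟨(s' - s) * Real.log 2 / 3,
      div_pos (mul_pos (sub_pos.2 hss') (Real.log_pos one_lt_two)) three_pos, by ring⟩
  have hev1 : ∀ᶠ N : ℕ in atTop, (D - η) * N < (1 - s') * Real.log (baseProd b N) := by
    by_contra h
    have hfr : ∃ᶠ N : ℕ in atTop, (1 - s') * Real.log (baseProd b N) ≤ (D - η) * N :=
      (not_eventually.1 h).mono fun N hN => not_lt.1 hN
    exact absurd (dimH_levelSet_le hb hd hα hne hd1 hs (sub_lt_self D hη0) hfr) (not_le.2 hs')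
  have hev2 : ∀ᶠ N : ℕ in atTop, D + η ≤ η * N :=
    (tendsto_natCast_atTop_atTop.const_mul_atTop hη0).eventually_ge_atTop _
  refine le_dimH_jointLevelSet_of_summable hb hd hS hs (κ := D + η) (by linarith) ?_ ?_
  · have := hs1.le.trans (dimH_le_one_real _)
    exact_mod_cast this
  · filter_upwards [hev1, hev2] with N h1 h2
    have h3 := mul_le_mul_of_nonneg_left (mul_log_two_le_log_baseProd hb N)
      (sub_pos.2 hss').le
    nlinarith

/-- Now `log B_N / N → H`, so both criteria have their threshold at `(1 - s) H = H - E`, that is, at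
`s = E / H`. -/
theorem dimH_levelSet_eq_entropyQuotient (hb : ∀ i, 2 ≤ b i) (hd : IsBaseFrequency b d)
    (hd1 : HasSum d 1) (hα : IsStochastic α) (hne : (admissible d α).Nonempty)
    (hs : Summable fun n : ℕ => d n * Real.log n)
    (hlim : Tendsto (fun N : ℕ => (∑ i ∈ range N, Real.log (b i)) / (N : ℝ)) atTop
      (𝓝 (∑' n : ℕ, d n * Real.log n))) :
    dimH (levelSet b α) = ENNReal.ofReal (entropyQuotient d (optMatrix d α)) := by
  have hd0 := baseFrequency_nonneg hd
  have hd2 : ∀ n < 2, d n = 0 := fun n hn => baseFrequency_eq_zero hb hd hn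
  have hadm := optMatrix_mem_admissible hα hd0 hd2 hd1 hne
  have hS := hadm.1
  have hHpos := tsum_mul_log_pos hd0 hd2 hd1 hs
  have hsE := summable_mul_rowEntropy hd0 hd2 hS hs
  have hEH := hsE.tsum_le_tsum (mul_rowEntropy_le hd0 hd2 hS) hs
  simp_rw [← log_baseProd hb] at hlim
  rw [entropyQuotient_eq hd2]
  set H := ∑' n : ℕ, d n * Real.log n with hH
  set E := ∑' n, d n * rowEntropy (optMatrix d α) n with hE
  refine le_antisymm (le_of_not_gt fun h => ?_) (le_of_forall_lt fun c hc => ?_)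
  · obtain ⟨s, h1, h2⟩ := ENNReal.lt_iff_exists_nnreal_btwn.1 h
    rw [← ENNReal.ofReal_coe_nnreal] at h1
    have h3 := (ENNReal.ofReal_lt_ofReal_iff'.1 h1).1
    rw [div_lt_iff₀ hHpos] at h3
    obtain ⟨κ, hκ1, hκ2⟩ := exists_between (show (1 - s) * H < H - E by linarith)
    refine absurd (dimH_levelSet_le hb hd hα hne hd1 hs hκ2 (s := s)
      (Eventually.frequently ?_)) (not_le.2 h2)
    filter_upwards [(hlim.const_mul (1 - (s : ℝ))).eventually (gt_mem_nhds hκ1),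
      eventually_gt_atTop 0] with N hN hN0
    have hNpos : (0 : ℝ) < N := by exact_mod_cast hN0
    rw [← mul_div_assoc, div_lt_iff₀ hNpos] at hN
    exact hN.le
  · obtain ⟨s, h1, h2⟩ := ENNReal.lt_iff_exists_nnreal_btwn.1 hc
    rw [← ENNReal.ofReal_coe_nnreal] at h2
    have h3 := (ENNReal.ofReal_lt_ofReal_iff'.1 h2).1
    have hs1 : s ≤ 1 := by
      have : (s : ℝ) ≤ 1 := h3.le.trans ((div_le_one hHpos).2 hEH)
      exact_mod_cast this
    rw [lt_div_iff₀ hHpos] at h3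
    refine h1.trans_le (le_trans ?_ (dimH_mono (jointLevelSet_subset_levelSet hb hd hd1 hadm)))
    obtain ⟨κ, hκ1, hκ2⟩ := exists_between (show H - E < (1 - s) * H by linarith)
    refine le_dimH_jointLevelSet_of_summable hb hd hS hs hκ1 hs1 ?_
    have hl : Tendsto (fun N : ℕ => (1 - (s : ℝ)) * (Real.log (baseProd b N) / N) - κ * (1 / N))
        atTop (𝓝 ((1 - s) * H - κ * 0)) :=
      (hlim.const_mul _).sub (tendsto_one_div_atTop_nhds_zero_nat.const_mul κ)
    rw [mul_zero, sub_zero] at hl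
    filter_upwards [hl.eventually (lt_mem_nhds hκ2), eventually_gt_atTop 0] with N hN hN0
    have hNpos : (0 : ℝ) < N := by exact_mod_cast hN0
    rw [← mul_div_assoc, ← mul_div_assoc, mul_one, ← sub_div, lt_div_iff₀ hNpos] at hN
    linarith

end Dimension

end CantorSeries

theorem mainTheorem2 (b : ℕ → ℕ) (hb : ∀ i, 2 ≤ b i)
    (d : ℕ → ℝ) (hd : CantorSeries.IsBaseFrequency b d) (hd1 : HasSum d 1)
    (α : ℕ → ℝ) (hα : CantorSeries.IsStochastic α)
    (hne : (CantorSeries.admissible d α).Nonempty) :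
    -- the matrix is admissible, and its entries are `r_n t_j`
    CantorSeries.optMatrix d α ∈ CantorSeries.admissible d α ∧
    (∀ n j, CantorSeries.jMin α ≤ j → j < n → CantorSeries.massA d α n ≠ 0 →
      ∏ k ∈ Finset.Icc (CantorSeries.jMin α + 1) j, CantorSeries.factor d α k ≠ 0 →
      CantorSeries.optMatrix d α n j = CantorSeries.rSeq d α n * CantorSeries.tSeq d α j) ∧
    -- rows that are not given by the formula belong to bases of frequency zero
    (∀ n, ¬ (CantorSeries.jMin α < n ∧ CantorSeries.massA d α n ≠ 0) → d n = 0) ∧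
    -- inclusion and equality of dimensions
    CantorSeries.jointLevelSet b d (CantorSeries.optMatrix d α) ⊆ CantorSeries.levelSet b α ∧
    dimH (CantorSeries.jointLevelSet b d (CantorSeries.optMatrix d α)) =
      dimH (CantorSeries.levelSet b α) ∧
    -- the supremum of the dimensions is the dimension of the level set and is attained
    dimH (CantorSeries.levelSet b α) =
      ⨆ P ∈ CantorSeries.admissible d α, dimH (CantorSeries.jointLevelSet b d P) ∧
    IsGreatest ((fun P => dimH (CantorSeries.jointLevelSet b d P)) ''
        CantorSeries.admissible d α)
      (dimH (CantorSeries.jointLevelSet b d (CantorSeries.optMatrix d α))) ∧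
    -- the supremum of the entropy quotients is attained, and equals the dimension
    (Summable (fun n : ℕ => d n * Real.log n) →
      IsGreatest (CantorSeries.entropyQuotient d '' CantorSeries.admissible d α)
        (CantorSeries.entropyQuotient d (CantorSeries.optMatrix d α)) ∧
      (Filter.Tendsto (fun N : ℕ => (∑ i ∈ Finset.range N, Real.log (b i)) / (N : ℝ))
          Filter.atTop (nhds (∑' n : ℕ, d n * Real.log n)) →
        dimH (CantorSeries.levelSet b α) =
          ENNReal.ofReal (CantorSeries.entropyQuotient d (CantorSeries.optMatrix d α)))) := by
  have hd0 := CantorSeries.baseFrequency_nonneg hd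
  have hd2 : ∀ n < 2, d n = 0 := fun n hn => CantorSeries.baseFrequency_eq_zero hb hd hn
  have hadm := CantorSeries.optMatrix_mem_admissible hα hd0 hd2 hd1 hne
  have hsub := CantorSeries.jointLevelSet_subset_levelSet hb hd hd1 hadm
  have hdim : dimH (CantorSeries.jointLevelSet b d (CantorSeries.optMatrix d α)) =
      dimH (CantorSeries.levelSet b α) :=
    le_antisymm (dimH_mono hsub)
      (CantorSeries.dimH_levelSet_le_dimH_jointLevelSet hb hd hd1 hα hne)
  have hmax : ∀ P ∈ CantorSeries.admissible d α,
      dimH (CantorSeries.jointLevelSet b d P) ≤ dimH (CantorSeries.levelSet b α) := fun P hP =>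
    dimH_mono (CantorSeries.jointLevelSet_subset_levelSet hb hd hd1 hP)
  refine ⟨hadm, fun n j h1 h2 h3 h4 => CantorSeries.optMatrix_eq_mul h1 h2 h3 h4,
    fun n hn => CantorSeries.baseFrequency_eq_zero_of_not hd0 hd2 hne hn, hsub, hdim,
    le_antisymm ?_ (iSup₂_le hmax), ⟨⟨_, hadm, rfl⟩, ?_⟩, fun hs =>
      ⟨CantorSeries.isGreatest_entropyQuotient hα hd0 hd2 hd1 hne hs, fun hlim =>
        CantorSeries.dimH_levelSet_eq_entropyQuotient hb hd hd1 hα hne hs hlim⟩⟩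
  · rw [← hdim]
    exact le_iSup₂ (f := fun P (_ : P ∈ CantorSeries.admissible d α) =>
      dimH (CantorSeries.jointLevelSet b d P)) _ hadm
  · rintro _ ⟨P, hP, rfl⟩
    rw [hdim]
    exact hmax P hP
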